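/- Let $\kappa>0$ and $c>2\kappa$, and let $Q\in C^3(\mathbb{R};\mathbb{R})$ be the profile of a solitary wave of the Camassa--Holm equation with speed $c$, i.e. $Q\not\equiv 0$, $Q(x)\to 0$ as $|x|\to\infty$, and $u(t,x)=Q(x-ct)$ satisfies $$(1-\partial_x^2)u_t+3uu_x+2\kappa u_x-2u_xu_{xx}-uu_{xxx}=0 .$$ Put $$M=\partial_x(Q-c)\partial_x+Q''-3Q+c-2\kappa,\qquad L=-\partial_x M\partial_x ,$$ where $M$ has domain $H^2(\mathbb{R})$ and $L$ is regarded as an unbounded operator in the complex Hilbert space $L^2(\mathbb{R})$ with domain $H^4(\mathbb{R})$; derivatives are taken in the sense of distributions. Then $L$ is defined on all of $H^4(\mathbb{R})$, it has exactly one negative eigenvalue $\lambda$, this eigenvalue is simple (its eigenspace is one-dimensional), and the rest of the spectrum is nonnegative: $\sigma(L)\setminus\{\lambda\}\subseteq[0,\infty)$. -/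

import Mathlib

open MeasureTheory Filter Topology
open scoped SchwartzMap ENNReal

noncomputable section

namespace CHKP

/-! ### Unbounded operators: composition, eigenspaces, spectrum -/

section Operators

variable {E : Type*} [NormedAddCommGroup E] [NormedSpace ℂ E]

/-- The composition `g ∘ f` of partially defined operators on its natural domain
`{x ∈ D(f) | f x ∈ D(g)}`. -/
def pcomp (g f : E →ₗ.[ℂ] E) : E →ₗ.[ℂ] E :=
  g.comp (f.domRestrict ((g.domain.comap f.toFun).map f.domain.subtype)) (by
    intro x
    obtain ⟨y, hy, hyx⟩ := x.2.1
    have h := LinearPMap.domRestrict_apply (f := f) (x := x) (y := y) hyx.symm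
    rw [h]
    exact hy)

theorem mem_pcomp_graph (g f : E →ₗ.[ℂ] E) (x z : E) :
    (x, z) ∈ (pcomp g f).graph ↔ ∃ y, (x, y) ∈ f.graph ∧ (y, z) ∈ g.graph := by
  simp only [LinearPMap.mem_graph_iff]
  constructor
  · rintro ⟨⟨_, ⟨y, hy, rfl⟩, hyf⟩, rfl, rfl⟩
    exact ⟨f y, ⟨y, rfl, rfl⟩, ⟨f y, hy⟩, rfl, rfl⟩
  · rintro ⟨_, ⟨y, rfl, rfl⟩, ⟨w, hw⟩, hwy, rfl⟩
    have hw' : w = f y := hwy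
    subst hw'
    exact ⟨⟨y, ⟨y, hw, rfl⟩, y.2⟩, rfl, rfl⟩

/-- The eigenspace `{x ∈ D(T) | T x = z x}`. -/
def eigenspace (T : E →ₗ.[ℂ] E) (z : ℂ) : Submodule ℂ E :=
  (LinearMap.ker (T.toFun - z • T.domain.subtype)).map T.domain.subtype

theorem mem_eigenspace (T : E →ₗ.[ℂ] E) (z : ℂ) (x : E) :
    x ∈ eigenspace T z ↔ ∃ y : T.domain, (y : E) = x ∧ T y = z • x := by
  simp only [eigenspace, Submodule.mem_map, LinearMap.mem_ker, LinearMap.sub_apply,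
    LinearMap.smul_apply, Submodule.subtype_apply, sub_eq_zero]
  constructor
  · rintro ⟨y, hy, rfl⟩
    exact ⟨y, rfl, hy⟩
  · rintro ⟨y, rfl, hy⟩
    exact ⟨y, hy, rfl⟩

/-- `z` is an eigenvalue of `T`. -/
def IsEigenvalue (T : E →ₗ.[ℂ] E) (z : ℂ) : Prop :=
  ∃ x : T.domain, x ≠ 0 ∧ T x = z • (x : E)

/-- The resolvent set: `T - z : D(T) → E` is bijective with a bounded inverse `R`. -/
def resolventSet (T : E →ₗ.[ℂ] E) : Set ℂ :=
  {z | ∃ R : E →L[ℂ] E,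
    (∀ f : E, ∃ x : T.domain, (x : E) = R f ∧ T x - z • (x : E) = f) ∧
    (∀ x : T.domain, R (T x - z • (x : E)) = x)}

/-- The spectrum of `T`. -/
def spectrum (T : E →ₗ.[ℂ] E) : Set ℂ := (resolventSet T)ᶜ

end Operators

/-! ### The operators `∂ₓ`, multiplication, and the Sobolev spaces in `L²(ℝ)` -/

/-- The space `L²(ℝ)` of complex-valued functions. -/
abbrev L2 : Type := Lp ℂ 2 (volume : Measure ℝ)

/-- The inclusion of `L²(ℝ)` into the tempered distributions. -/
abbrev toDistr : L2 →L[ℂ] 𝓢'(ℝ, ℂ) := Lp.toTemperedDistributionCLM ℂ volume 2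

/-- The Sobolev space `H^k(ℝ)` as a subspace of `L²(ℝ)`. -/
def sobolevH (k : ℕ) : Submodule ℂ L2 where
  carrier := {f | TemperedDistribution.MemSobolev (k : ℝ) 2 (toDistr f)}
  add_mem' {f g} hf hg := by
    simp only [Set.mem_ofPred_eq, map_add] at *
    exact hf.add hg
  zero_mem' := by
    simp only [Set.mem_ofPred_eq, map_zero]
    exact TemperedDistribution.memSobolev_fun_zero ℝ ℂ _ _
  smul_mem' a f hf := by
    simp only [Set.mem_ofPred_eq, map_smul] at *
    exact hf.smul a

/-- The set of pairs `(f, g)` in `L²(ℝ) × L²(ℝ)` with `g = f'` in the sense of distributions. -/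
def derivGraph : Submodule ℂ (L2 × L2) where
  carrier := {p | TemperedDistribution.derivCLM ℂ (toDistr p.1) = toDistr p.2}
  add_mem' {p q} hp hq := by
    simp only [Set.mem_ofPred_eq, Prod.fst_add, Prod.snd_add, map_add] at *
    rw [hp, hq]
  zero_mem' := by simp only [Set.mem_ofPred_eq, Prod.fst_zero, Prod.snd_zero, map_zero]
  smul_mem' a p hp := by
    simp only [Set.mem_ofPred_eq, Prod.smul_fst, Prod.smul_snd, map_smul] at *
    rw [hp]

/-- The operator `∂ₓ` in `L²(ℝ)`, defined on all `f ∈ L²(ℝ)` whose distributional derivative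
belongs to `L²(ℝ)`. -/
def dX : L2 →ₗ.[ℂ] L2 := derivGraph.toLinearPMap

theorem mem_dX_graph (f g : L2) :
    (f, g) ∈ dX.graph ↔ TemperedDistribution.derivCLM ℂ (toDistr f) = toDistr g := by
  have h : dX.graph = derivGraph := by
    refine Submodule.toLinearPMap_graph_eq _ ?_
    rintro ⟨u, v⟩ huv (rfl : u = 0)
    have h1 : TemperedDistribution.derivCLM ℂ (toDistr (0 : L2)) = toDistr v := huv
    rw [map_zero, map_zero] at h1
    have h2 : v ∈ (Lp.toTemperedDistributionCLM ℂ (volume : Measure ℝ) 2).ker := h1.symm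
    rw [Lp.ker_toTemperedDistributionCLM_eq_bot] at h2
    exact h2
  rw [h]
  exact Iff.rfl

/-- The set of pairs `(f, g)` in `L²(ℝ) × L²(ℝ)` with `g = a f` almost everywhere. -/
def mulGraph (a : ℝ → ℝ) : Submodule ℂ (L2 × L2) where
  carrier := {p | ∀ᵐ x : ℝ, p.2 x = (a x : ℂ) * p.1 x}
  add_mem' {p q} hp hq := by
    simp only [Set.mem_ofPred_eq, Prod.fst_add, Prod.snd_add] at *
    filter_upwards [hp, hq, Lp.coeFn_add p.1 q.1, Lp.coeFn_add p.2 q.2] with x h1 h2 h3 h4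
    rw [h3, h4, Pi.add_apply, Pi.add_apply, h1, h2, mul_add]
  zero_mem' := by
    simp only [Set.mem_ofPred_eq, Prod.fst_zero, Prod.snd_zero]
    filter_upwards [Lp.coeFn_zero ℂ 2 (volume : Measure ℝ)] with x h
    rw [h, Pi.zero_apply, mul_zero]
  smul_mem' b p hp := by
    simp only [Set.mem_ofPred_eq, Prod.smul_fst, Prod.smul_snd] at *
    filter_upwards [hp, Lp.coeFn_smul b p.1, Lp.coeFn_smul b p.2] with x h1 h2 h3
    rw [h2, h3, Pi.smul_apply, Pi.smul_apply, h1, smul_eq_mul, smul_eq_mul, mul_left_comm]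

/-- Multiplication by the function `a`, defined on all `f ∈ L²(ℝ)` with `a f ∈ L²(ℝ)`. -/
def mulOp (a : ℝ → ℝ) : L2 →ₗ.[ℂ] L2 := (mulGraph a).toLinearPMap

theorem mem_mulOp_graph (a : ℝ → ℝ) (f g : L2) :
    (f, g) ∈ (mulOp a).graph ↔ ∀ᵐ x : ℝ, g x = (a x : ℂ) * f x := by
  have h : (mulOp a).graph = mulGraph a := by
    refine Submodule.toLinearPMap_graph_eq _ ?_
    rintro ⟨u, v⟩ huv (rfl : u = 0)
    have h1 : ∀ᵐ x : ℝ, v x = (a x : ℂ) * (0 : L2) x := huv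
    change v = 0
    rw [Lp.eq_zero_iff_ae_eq_zero]
    filter_upwards [h1, Lp.coeFn_zero ℂ 2 (volume : Measure ℝ)] with x h2 h3
    rw [h2, h3, Pi.zero_apply, mul_zero]
  rw [h]
  exact Iff.rfl

/-! ### The Camassa–Holm equation and its solitary waves -/

/-- `u = u(t, x)` solves the Camassa–Holm equation
`(1 - ∂ₓ²) u_t + 3 u u_x + 2 κ u_x - 2 u_x u_xx - u u_xxx = 0` pointwise. -/
def IsCHSolution (κ : ℝ) (u : ℝ → ℝ → ℝ) : Prop :=
  ∀ t x : ℝ,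
    deriv (fun s => u s x) t - iteratedDeriv 2 (fun y => deriv (fun s => u s y) t) x
      + 3 * u t x * deriv (u t) x + 2 * κ * deriv (u t) x
      - 2 * deriv (u t) x * iteratedDeriv 2 (u t) x - u t x * iteratedDeriv 3 (u t) x = 0

/-- `Q` is the profile of a (nontrivial, classical) solitary wave solution
`u(t, x) = Q(x - c t)` of the Camassa–Holm equation. -/
structure IsSolitaryWave (κ c : ℝ) (Q : ℝ → ℝ) : Prop where
  contDiff : ContDiff ℝ 3 Q
  ne_zero : Q ≠ 0
  tendsto_zero : Tendsto Q (cocompact ℝ) (𝓝 0)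
  isCHSolution : IsCHSolution κ (fun t x => Q (x - c * t))

/-! ### The operators `M` and `L` -/

/-- `M = ∂ₓ (Q - c) ∂ₓ + Q'' - 3 Q + c - 2 κ` with domain in `H²(ℝ)`. -/
def opM (κ c : ℝ) (Q : ℝ → ℝ) : L2 →ₗ.[ℂ] L2 :=
  (pcomp dX (pcomp (mulOp (fun x => Q x - c)) dX)
    + mulOp (fun x => iteratedDeriv 2 Q x - 3 * Q x + c - 2 * κ)).domRestrict (sobolevH 2)

/-- `L = -∂ₓ M ∂ₓ` with domain in `H⁴(ℝ)`. -/
def opL (κ c : ℝ) (Q : ℝ → ℝ) : L2 →ₗ.[ℂ] L2 :=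
  (-(pcomp dX (pcomp (opM κ c Q) dX))).domRestrict (sobolevH 4)

end CHKP

end

open MeasureTheory Filter Topology
open scoped SchwartzMap ENNReal InnerProductSpace FourierTransform

noncomputable section

namespace CHKP

/-! ### Bounded multiplication operators and Fourier multipliers on `L²(ℝ)`. -/

section Multipliers

/-! The quadratic form of `L` at `f` is that of `M` at `u = f'`, namely `∫ (c - Q) |u'|² + q |u|²`
with `q = Q'' - 3 Q + c - 2 κ`. Translation invariance gives `M Q' = 0`. Two integrations of the
wave equation give `(c - Q) Q'² = Q² (c - 2 κ - Q)` and `0 < Q ≤ c - 2 κ`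
(`IsSolitaryWave.isProfile`), so `Q'` vanishes only at the crest, and there simply
(`IsProfile.crit_unique`, `IsProfile.Q2_neg_of_crit`). Jacobi's substitution `u = Q' v` then makes
the form nonnegative on every `u` that vanishes at the crest
(`IsProfile.integral_form_nonneg_of_crest`): it is nonnegative on a hyperplane. It is negative at `u
= Q` (`IsProfile.integral_form_neg`). Though `Q` is not the derivative of an `L²` function, such
derivatives are dense in `H¹`, so `L` inherits a negative direction (`mem_closure_opD_opDD`).

To avoid unbounded operators, write `f = J w` with the Bessel potential `J` of symbol `(1 + ξ²)⁻¹`,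
which maps `L²` onto `H²`. Applying `J` to `(L - z) f = y` gives `(A - z J²) w = J y`, where `A`
extends `J L J` to a bounded symmetric operator on `L²`. Elliptic regularity gives the converse
(`mem_graph_of_opA_eq`), so eigenvectors and resolvents of `L` are read off from the pencil `A - z
J²`.

The rest is Hilbert space theory (`exists_unique_negative_eigenvalue_pencil`). Gårding's inequality
and nonnegativity on a hyperplane make the pencil coercive on that hyperplane for every `z` outside
`[0, ∞)`, and there injectivity implies bijectivity. No compactness is used: were the infimum of the
Rayleigh quotient not an eigenvalue, the pencil at that value would be invertible and nonnegative,
hence coercive, and the infimum would be larger. A second negative eigenvector would give a negative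
plane, which meets the hyperplane. -/

/-- Multiplication by an essentially bounded function, as a bounded operator on `L²(ℝ)`. -/
def mulL (a : ℝ → ℂ) (ha : MemLp a ∞ (volume : Measure ℝ)) : L2 →L[ℂ] L2 :=
  (ContinuousLinearMap.lsmul ℂ ℂ).holderL volume ∞ 2 2 (ha.toLp a)

theorem mulL_ae (a : ℝ → ℂ) (ha : MemLp a ∞ (volume : Measure ℝ)) (f : L2) :
    ∀ᵐ x, mulL a ha f x = a x * f x := by
  have h : (mulL a ha f : L2) = (ContinuousLinearMap.lsmul ℂ ℂ).holder 2 (ha.toLp a) f := rfl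
  rw [h]
  filter_upwards [(ContinuousLinearMap.lsmul ℂ ℂ).coeFn_holder (r := 2) (ha.toLp a) f,
    ha.coeFn_toLp] with x h1 h2
  rw [h1, h2]; rfl

theorem toDistr_mulL (a : ℝ → ℂ) (ha : MemLp a ∞ (volume : Measure ℝ))
    (hg : a.HasTemperateGrowth) (f : L2) :
    toDistr (mulL a ha f) = TemperedDistribution.smulLeftCLM ℂ a (toDistr f) :=
  MeasureTheory.Lp.toTemperedDistribution_smul_eq hg ha f

theorem toDistr_injective : Function.Injective toDistr := by
  have := Lp.ker_toTemperedDistributionCLM_eq_bot (F := ℂ) (μ := (volume : Measure ℝ)) (p := 2)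
  exact LinearMap.ker_eq_bot.1 this

theorem L2_inner (f g : L2) : ⟪f, g⟫_ℂ = ∫ x, starRingEnd ℂ (f x) * g x := by
  rw [L2.inner_def]
  refine integral_congr_ae (Eventually.of_forall fun x => ?_)
  simp [mul_comm]

/-- The Fourier multiplier with bounded symbol `a`, as a bounded operator on `L²(ℝ)`. -/
def fmul (a : ℝ → ℂ) (ha : MemLp a ∞ (volume : Measure ℝ)) : L2 →L[ℂ] L2 :=
  (FourierTransform.fourierInvCLM ℂ L2) ∘L mulL a ha ∘L (FourierTransform.fourierCLM ℂ L2)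

theorem fourier_fmul (a : ℝ → ℂ) (ha : MemLp a ∞ (volume : Measure ℝ)) (f : L2) :
    𝓕 (fmul a ha f) = mulL a ha (𝓕 f) := by
  change 𝓕 (𝓕⁻ (mulL a ha (𝓕 f))) = _
  exact FourierTransform.fourier_fourierInv_eq _

theorem fourier_fmul_ae (a : ℝ → ℂ) (ha : MemLp a ∞ (volume : Measure ℝ)) (f : L2) :
    ∀ᵐ x, (𝓕 (fmul a ha f) : L2) x = a x * (𝓕 f : L2) x := by
  rw [fourier_fmul]; exact mulL_ae a ha _

theorem toDistr_fmul (a : ℝ → ℂ) (ha : MemLp a ∞ (volume : Measure ℝ))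
    (hg : a.HasTemperateGrowth) (f : L2) :
    toDistr (fmul a ha f) = TemperedDistribution.fourierMultiplierCLM ℂ a (toDistr f) := by
  rw [TemperedDistribution.fourierMultiplierCLM_apply]
  change ((𝓕⁻ (mulL a ha (𝓕 f)) : L2) : 𝓢'(ℝ, ℂ)) =
    𝓕⁻ (TemperedDistribution.smulLeftCLM ℂ a (𝓕 (f : 𝓢'(ℝ, ℂ))))
  rw [← Lp.fourierInv_toTemperedDistribution_eq, Lp.fourier_toTemperedDistribution_eq]
  congr 1
  exact toDistr_mulL a ha hg _

theorem L2_ext_fourier {f g : L2} (h : ∀ᵐ x, (𝓕 f : L2) x = (𝓕 g : L2) x) : f = g := by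
  have h1 : (𝓕 f : L2) = 𝓕 g := Lp.ext h
  rw [← FourierTransform.fourierInv_fourier_eq (F := L2) f, h1,
    FourierTransform.fourierInv_fourier_eq]

theorem inner_fmul_left (a b : ℝ → ℂ) (ha : MemLp a ∞ (volume : Measure ℝ))
    (hb : MemLp b ∞ (volume : Measure ℝ)) (hab : ∀ x, b x = starRingEnd ℂ (a x)) (f g : L2) :
    ⟪fmul a ha f, g⟫_ℂ = ⟪f, fmul b hb g⟫_ℂ := by
  rw [← Lp.inner_fourier_eq, ← Lp.inner_fourier_eq f, L2_inner, L2_inner]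
  refine integral_congr_ae ?_
  filter_upwards [fourier_fmul_ae a ha f, fourier_fmul_ae b hb g] with x h1 h2
  rw [h1, h2, hab, map_mul]; ring

theorem inner_mulL_left (a : ℝ → ℂ) (ha : MemLp a ∞ (volume : Measure ℝ))
    (hr : ∀ x, starRingEnd ℂ (a x) = a x) (f g : L2) :
    ⟪mulL a ha f, g⟫_ℂ = ⟪f, mulL a ha g⟫_ℂ := by
  rw [L2_inner, L2_inner]
  refine integral_congr_ae ?_
  filter_upwards [mulL_ae a ha f, mulL_ae a ha g] with x h1 h2
  rw [h1, h2, map_mul, hr]; ring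

/-- The symbol of the Bessel potential of order `-2`. -/
def symJ (x : ℝ) : ℂ := ((1 + ‖x‖ ^ 2) ^ ((-2 : ℝ) / 2) : ℝ)

/-- The symbol of the derivative of the Bessel potential of order `-2`. -/
def symD (x : ℝ) : ℂ := 2 * Real.pi * Complex.I * x * symJ x

theorem symJ_eq (x : ℝ) : symJ x = ((1 + x ^ 2)⁻¹ : ℝ) := by
  simp only [symJ, Real.norm_eq_abs, sq_abs]
  norm_num [Real.rpow_neg_one]

theorem symJ_temperate : symJ.HasTemperateGrowth := by
  unfold symJ; fun_prop

theorem symD_temperate : symD.HasTemperateGrowth := by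
  unfold symD
  have := symJ_temperate
  fun_prop

theorem norm_symJ_le (x : ℝ) : ‖symJ x‖ ≤ 1 := by
  rw [symJ_eq, Complex.norm_real, Real.norm_eq_abs, abs_of_pos (by positivity)]
  exact inv_le_one_of_one_le₀ (by nlinarith [sq_nonneg x])

theorem norm_symD_sq_le (x : ℝ) : ‖symD x‖ ^ 2 ≤ 4 * Real.pi ^ 2 * (1 + x ^ 2)⁻¹ := by
  rw [symD, symJ_eq, norm_mul, norm_mul, norm_mul, norm_mul, Complex.norm_real, Complex.norm_I,
    Complex.norm_real, Complex.norm_real, Real.norm_eq_abs, Real.norm_eq_abs, Real.norm_eq_abs,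
    mul_pow, mul_pow, mul_pow, mul_pow, sq_abs, sq_abs, sq_abs, Complex.norm_ofNat]
  have h : x ^ 2 * ((1 + x ^ 2)⁻¹) ^ 2 ≤ (1 + x ^ 2)⁻¹ := by
    rw [inv_pow, ← div_eq_mul_inv, ← one_div, div_le_div_iff₀ (by positivity) (by positivity)]
    nlinarith [sq_nonneg x]
  have := mul_le_mul_of_nonneg_left h (by positivity : 0 ≤ 4 * Real.pi ^ 2)
  linarith

theorem norm_symD_le (x : ℝ) : ‖symD x‖ ≤ 2 * Real.pi := by
  refine abs_le_of_sq_le_sq' ?_ (by positivity) |>.2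
  refine (norm_symD_sq_le x).trans ?_
  have : (1 + x ^ 2)⁻¹ ≤ 1 := inv_le_one_of_one_le₀ (by nlinarith [sq_nonneg x])
  nlinarith [Real.pi_pos, sq_nonneg Real.pi]

theorem symJ_memLp : MemLp symJ ∞ (volume : Measure ℝ) :=
  memLp_top_of_bound symJ_temperate.1.continuous.aestronglyMeasurable 1
    (Eventually.of_forall norm_symJ_le)

theorem symD_memLp : MemLp symD ∞ (volume : Measure ℝ) :=
  memLp_top_of_bound symD_temperate.1.continuous.aestronglyMeasurable _
    (Eventually.of_forall norm_symD_le)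

/-- The Bessel potential of order `-2` on `L²(ℝ)`. -/
def opJ : L2 →L[ℂ] L2 := fmul symJ symJ_memLp

/-- The operator `∂ₓ J` on `L²(ℝ)`. -/
def opD : L2 →L[ℂ] L2 := fmul symD symD_memLp

theorem toDistr_opJ (f : L2) :
    toDistr (opJ f) = TemperedDistribution.besselPotential ℝ ℂ (-2) (toDistr f) :=
  toDistr_fmul _ _ symJ_temperate f

theorem inner_opJ (f g : L2) : ⟪f, opJ g⟫_ℂ = ⟪opJ f, g⟫_ℂ :=
  (inner_fmul_left _ _ _ _ (fun x => by rw [symJ_eq, Complex.conj_ofReal]) f g).symm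

theorem inner_opD (f g : L2) : ⟪f, opD g⟫_ℂ = -⟪opD f, g⟫_ℂ := by
  rw [← Lp.inner_fourier_eq, ← Lp.inner_fourier_eq (opD f), L2_inner, L2_inner, ← integral_neg]
  refine integral_congr_ae ?_
  filter_upwards [fourier_fmul_ae _ symD_memLp f, fourier_fmul_ae _ symD_memLp g] with x h1 h2
  simp only [opD]
  rw [h1, h2, map_mul, symD, symJ_eq]
  simp [map_ofNat]
  ring

theorem opJ_opD (f : L2) : opJ (opD f) = opD (opJ f) := by
  refine L2_ext_fourier ?_
  filter_upwards [fourier_fmul_ae _ symD_memLp f, fourier_fmul_ae _ symJ_memLp f,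
    fourier_fmul_ae _ symD_memLp (opJ f), fourier_fmul_ae _ symJ_memLp (opD f)] with x h1 h2 h3 h4
  simp only [opD, opJ] at *
  rw [h4, h1, h3, h2]; ring

/-- The operator `∂ₓ² J` on `L²(ℝ)`. -/
def opDD : L2 →L[ℂ] L2 := ((4 * Real.pi ^ 2 : ℝ) : ℂ) • (opJ - ContinuousLinearMap.id ℂ L2)

theorem opDD_apply (f : L2) : opDD f = ((4 * Real.pi ^ 2 : ℝ) : ℂ) • (opJ f - f) := rfl

/-- The identity `(2πiξ)² / (1 + ξ²) = 4π² ((1 + ξ²)⁻¹ - 1)` justifies the definition of `opDD`,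
which makes boundedness and symmetry immediate from those of `opJ`. -/
theorem fourier_opDD_ae (f : L2) :
    ∀ᵐ x, (𝓕 (opDD f) : L2) x = (2 * Real.pi * Complex.I * x) ^ 2 * symJ x * (𝓕 f : L2) x := by
  have h : (𝓕 (opDD f) : L2) = ((4 * Real.pi ^ 2 : ℝ) : ℂ) • ((𝓕 (opJ f) : L2) - 𝓕 f) := by
    rw [opDD_apply, FourierTransform.fourier_smul]
    congr 1
    exact map_sub (FourierTransform.fourierCLM ℂ L2) _ _
  rw [h]
  filter_upwards [fourier_fmul_ae _ symJ_memLp f,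
    Lp.coeFn_smul ((4 * Real.pi ^ 2 : ℝ) : ℂ) ((𝓕 (opJ f) : L2) - 𝓕 f),
    Lp.coeFn_sub (𝓕 (opJ f) : L2) (𝓕 f)] with x h1 h2 h3
  simp only [opJ] at *
  rw [h2, Pi.smul_apply, h3, Pi.sub_apply, h1, symJ_eq, smul_eq_mul]
  have h4 : ((1 : ℂ) + x ^ 2) ≠ 0 := by
    have : (1 + x ^ 2 : ℝ) ≠ 0 := by positivity
    exact_mod_cast this
  push_cast
  rw [mul_pow, mul_pow, Complex.I_sq]
  field_simp
  ring

end Multipliers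

/-! ### The derivative on the Fourier side, and the spaces `H²` and `H⁴`. -/

section Derivative

theorem derivCLM_eq (u : 𝓢'(ℝ, ℂ)) : TemperedDistribution.derivCLM ℂ u =
    TemperedDistribution.fourierMultiplierCLM ℂ (fun x : ℝ => 2 * Real.pi * Complex.I * x) u := by
  have h1 : TemperedDistribution.derivCLM ℂ u = LineDeriv.lineDerivOp (1 : ℝ) u := by
    ext φ
    simp only [TemperedDistribution.derivCLM_apply_apply,
      TemperedDistribution.lineDerivOp_apply_apply]
    congr 2
  rw [h1, TemperedDistribution.lineDeriv_eq_fourierMultiplierCLM]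
  have h2 : (fun x : ℝ => (2 * Real.pi * Complex.I * x : ℂ)) =
      (2 * Real.pi * Complex.I : ℂ) • (fun x : ℝ => ((inner ℝ x (1:ℝ) : ℝ) : ℂ)) := by
    ext x; simp
  rw [h2, TemperedDistribution.fourierMultiplierCLM_smul (by fun_prop)]
  rfl

/-- The Bessel potential of order `-2` is invertible on tempered distributions, so `f' = g` may be
tested after applying it. Both sides become bounded operators on `L²`, and the graph of `∂ₓ` is
visibly closed. -/
theorem mem_dX_iff (f g : L2) : (f, g) ∈ dX.graph ↔ opD f = opJ g := by
  rw [mem_dX_graph]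
  have hD : ∀ f, toDistr (opD f) = TemperedDistribution.besselPotential ℝ ℂ (-2)
      (TemperedDistribution.derivCLM ℂ (toDistr f)) := by
    intro f
    rw [derivCLM_eq]
    refine Eq.trans ?_ (TemperedDistribution.fourierMultiplierCLM_fourierMultiplierCLM_apply
        (g₁ := fun x : ℝ => 2 * Real.pi * Complex.I * x) (g₂ := symJ)
        (by fun_prop) symJ_temperate (toDistr f)).symm
    exact toDistr_fmul _ _ symD_temperate f
  constructor
  · intro h
    apply toDistr_injective
    rw [hD, toDistr_opJ, h]
  · intro h
    have h1 := congrArg toDistr h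
    rw [hD, toDistr_opJ] at h1
    have h2 := congrArg (TemperedDistribution.besselPotential ℝ ℂ 2) h1
    simpa using h2

theorem mem_dX_iff_fourier (f g : L2) : (f, g) ∈ dX.graph ↔
    ∀ᵐ x, (𝓕 g : L2) x = 2 * Real.pi * Complex.I * x * (𝓕 f : L2) x := by
  have hne : ∀ x, symJ x ≠ 0 := fun x => by
    rw [symJ_eq]; exact_mod_cast (by positivity : (1 + x ^ 2)⁻¹ ≠ 0)
  rw [mem_dX_iff]
  constructor
  · intro h
    filter_upwards [fourier_fmul_ae _ symD_memLp f, fourier_fmul_ae _ symJ_memLp g] with x h1 h2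
    simp only [opD, opJ] at h
    rw [h, h2, symD] at h1
    apply mul_left_cancel₀ (hne x)
    rw [h1]; ring
  · intro h
    refine L2_ext_fourier ?_
    filter_upwards [fourier_fmul_ae _ symD_memLp f, fourier_fmul_ae _ symJ_memLp g, h]
      with x h1 h2 h3
    simp only [opD, opJ]
    rw [h1, h2, h3, symD]; ring

theorem opJ_opD_mem (f : L2) : (opJ f, opD f) ∈ dX.graph := by
  rw [mem_dX_iff, opJ_opD]

theorem opD_opDD_mem (f : L2) : (opD f, opDD f) ∈ dX.graph := by
  rw [mem_dX_iff_fourier]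
  filter_upwards [fourier_fmul_ae _ symD_memLp f, fourier_opDD_ae f] with x h1 h2
  simp only [opD] at *
  rw [h2, h1, symD]; ring

theorem opD_eq_of_mem {f g : L2} (h : (f, g) ∈ dX.graph) : opD f = opJ g := (mem_dX_iff f g).1 h

theorem opD_eq_opDD_of_mem {f g : L2} (h : (f, g) ∈ dX.graph) : opD g = opDD f := by
  refine L2_ext_fourier ?_
  filter_upwards [fourier_fmul_ae _ symD_memLp g, fourier_opDD_ae f,
    (mem_dX_iff_fourier f g).1 h] with x h1 h2 h3
  simp only [opD] at *
  rw [h2, h1, symD, h3]; ring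

theorem dX_unique {f g g' : L2} (h : (f, g) ∈ dX.graph) (h' : (f, g') ∈ dX.graph) : g = g' :=
  dX.mem_graph_snd_inj h h' rfl

theorem inner_dX {f g u v : L2} (h : (f, g) ∈ dX.graph) (h' : (u, v) ∈ dX.graph) :
    ⟪g, u⟫_ℂ = -⟪f, v⟫_ℂ := by
  rw [← Lp.inner_fourier_eq, ← Lp.inner_fourier_eq f, L2_inner, L2_inner, ← integral_neg]
  refine integral_congr_ae ?_
  filter_upwards [(mem_dX_iff_fourier f g).1 h, (mem_dX_iff_fourier u v).1 h'] with x h1 h2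
  rw [h1, h2]
  simp [map_ofNat]
  ring

/-- The second derivative of `J f` is `4π² (J f - f)`, from which `f` is recovered. -/
theorem opJ_injective (f : L2) (h : opJ f = 0) : f = 0 := by
  have h1 : (0 : L2) = opD f := dX_unique (f := 0) (dX.graph.zero_mem) (h ▸ opJ_opD_mem f)
  have h2 : (0 : L2) = opDD f := dX_unique (f := 0) (dX.graph.zero_mem) (h1 ▸ opD_opDD_mem f)
  rw [opDD_apply, h] at h2
  have : ((4 * Real.pi ^ 2 : ℝ) : ℂ) ≠ 0 := by
    exact_mod_cast (by positivity : (4 * Real.pi ^ 2 : ℝ) ≠ 0)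
  simpa [this] using h2.symm

/-- The symbol `2πiξ` vanishes only on the null set `{0}`. -/
theorem eq_zero_of_dX_zero {f : L2} (h : (f, 0) ∈ dX.graph) : f = 0 := by
  have h0 : ∀ᵐ x : ℝ, x ≠ 0 := by simp [ae_iff, measure_singleton]
  have hz : (𝓕 (0 : L2) : L2) = 0 := map_zero (FourierTransform.fourierCLM ℂ L2)
  refine L2_ext_fourier ?_
  have hm := (mem_dX_iff_fourier f 0).1 h
  rw [hz] at hm
  filter_upwards [hm, h0, Lp.coeFn_zero ℂ 2 (volume : Measure ℝ)]
    with x h1 h2 h3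
  rw [h3] at h1
  rw [hz, h3, Pi.zero_apply]
  rw [Pi.zero_apply] at h1
  have h4 : (2 * Real.pi * Complex.I * x : ℂ) ≠ 0 := by
    simp [Real.pi_ne_zero, h2]
  exact (mul_eq_zero.1 h1.symm).resolve_left h4

theorem norm_opJ_le (f : L2) : ‖opJ f‖ ≤ ‖f‖ := by
  rw [← Lp.norm_fourier_eq, ← Lp.norm_fourier_eq f]
  refine Lp.norm_le_norm_of_ae_le ?_
  filter_upwards [fourier_fmul_ae _ symJ_memLp f] with x h1
  simp only [opJ]
  rw [h1, norm_mul]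
  exact mul_le_of_le_one_left (norm_nonneg _) (norm_symJ_le x)

/-- A differentiable function that is square integrable together with its derivative is in the
domain of `∂ₓ`, with its classical derivative. -/
theorem toLp_mem_dX {ψ ψ' : ℝ → ℂ} (hd : ∀ x, HasDerivAt ψ (ψ' x) x) (h : MemLp ψ 2 volume)
    (h' : MemLp ψ' 2 volume) : (h.toLp ψ, h'.toLp ψ') ∈ dX.graph := by
  rw [mem_dX_graph]
  ext φ
  have hφ : ∀ x, HasDerivAt φ (SchwartzMap.derivCLM ℂ ℂ φ x) x := fun x => by
    rw [SchwartzMap.derivCLM_apply]; exact φ.differentiableAt.hasDerivAt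
  have hφ2 := φ.memLp 2 (volume : Measure ℝ)
  have hφ'2 := (SchwartzMap.derivCLM ℂ ℂ φ).memLp 2 (volume : Measure ℝ)
  have key := integral_mul_deriv_eq_deriv_mul_of_integrable (fun x _ => hφ x)
    (fun x _ => hd x) (h'.integrable_mul hφ2 |>.congr
    (Eventually.of_forall fun x => mul_comm _ _)) (hφ'2.integrable_mul h) (hφ2.integrable_mul h)
  rw [TemperedDistribution.derivCLM_apply_apply]
  change Lp.toTemperedDistribution _ _ = Lp.toTemperedDistribution _ _
  rw [Lp.toTemperedDistribution_apply, Lp.toTemperedDistribution_apply]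
  have e1 : (∫ x, φ x • (h'.toLp ψ') x) = ∫ x, φ x * ψ' x := by
    refine integral_congr_ae ?_
    filter_upwards [h'.coeFn_toLp] with x hx
    rw [hx, smul_eq_mul]
  have e2 : (∫ x, (-SchwartzMap.derivCLM ℂ ℂ φ) x • (h.toLp ψ) x)
      = -∫ x, SchwartzMap.derivCLM ℂ ℂ φ x * ψ x := by
    rw [← integral_neg]
    refine integral_congr_ae ?_
    filter_upwards [h.coeFn_toLp] with x hx
    rw [hx, smul_eq_mul, neg_apply, neg_mul]
  rw [e1, e2, key]

/-- The product rule in `H¹(ℝ)`. -/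
theorem mulL_mem_dX {a a' : ℝ → ℂ} (hd : ∀ x, HasDerivAt a (a' x) x)
    (ha : MemLp a ∞ (volume : Measure ℝ)) (ha' : MemLp a' ∞ (volume : Measure ℝ)) {f g : L2}
    (h : (f, g) ∈ dX.graph) : (mulL a ha f, mulL a' ha' f + mulL a ha g) ∈ dX.graph := by
  rw [mem_dX_graph]
  ext φ
  rw [TemperedDistribution.derivCLM_apply_apply]
  change Lp.toTemperedDistribution _ _ = Lp.toTemperedDistribution _ _
  rw [Lp.toTemperedDistribution_apply, Lp.toTemperedDistribution_apply]
  have hφ : ∀ x, HasDerivAt φ (SchwartzMap.derivCLM ℂ ℂ φ x) x := fun x => by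
    rw [SchwartzMap.derivCLM_apply]; exact φ.differentiableAt.hasDerivAt
  have hφ2 := φ.memLp 2 (volume : Measure ℝ)
  have hφ'2 := (SchwartzMap.derivCLM ℂ ℂ φ).memLp 2 (volume : Measure ℝ)
  set φ' := SchwartzMap.derivCLM ℂ ℂ φ with hφ'
  -- the conjugate of `a φ` is an admissible test function
  have hψ2 : MemLp (fun x => starRingEnd ℂ (a x * φ x)) 2 (volume : Measure ℝ) :=
    (MemLp.star (hφ2.mul (r := 2) ha))
  have hψ'2 : MemLp (fun x => starRingEnd ℂ (a' x * φ x + a x * φ' x)) 2 (volume : Measure ℝ) :=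
    (MemLp.star ((hφ2.mul (r := 2) ha').add (hφ'2.mul (r := 2) ha)))
  have hψd : ∀ x, HasDerivAt (fun x => starRingEnd ℂ (a x * φ x))
      (starRingEnd ℂ (a' x * φ x + a x * φ' x)) x := fun x =>
    ((hd x).mul (hφ x)).star
  have key := inner_dX (toLp_mem_dX hψd hψ2 hψ'2) h
  rw [L2_inner, L2_inner, ← integral_neg] at key
  have e1 : (∫ x, φ x • (mulL a' ha' f + mulL a ha g) x)
      = (∫ x, φ x * (a' x * f x)) + ∫ x, φ x * (a x * g x) := by
    rw [← integral_add]
    · refine integral_congr_ae ?_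
      filter_upwards [mulL_ae a' ha' f, mulL_ae a ha g, Lp.coeFn_add (mulL a' ha' f) (mulL a ha g)]
        with x h1 h2 h3
      rw [h3, Pi.add_apply, h1, h2, smul_eq_mul, mul_add]
    · exact hφ2.integrable_mul ((Lp.memLp f).mul (r := 2) ha')
    · exact hφ2.integrable_mul ((Lp.memLp g).mul (r := 2) ha)
  have e2 : (∫ x, (-φ') x • (mulL a ha f) x) = -∫ x, φ' x * (a x * f x) := by
    rw [← integral_neg]
    refine integral_congr_ae ?_
    filter_upwards [mulL_ae a ha f] with x h1
    rw [h1, smul_eq_mul, neg_apply, neg_mul]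
  have e3 : ∫ x, starRingEnd ℂ ((hψ'2.toLp _) x) * f x
      = (∫ x, φ x * (a' x * f x)) + ∫ x, φ' x * (a x * f x) := by
    rw [← integral_add]
    · refine integral_congr_ae ?_
      filter_upwards [hψ'2.coeFn_toLp] with x h1
      rw [h1, Complex.conj_conj]; ring
    · exact hφ2.integrable_mul ((Lp.memLp f).mul (r := 2) ha')
    · exact hφ'2.integrable_mul ((Lp.memLp f).mul (r := 2) ha)
  have e4 : ∫ x, -(starRingEnd ℂ ((hψ2.toLp _) x) * g x) = -∫ x, φ x * (a x * g x) := by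
    rw [← integral_neg]
    refine integral_congr_ae ?_
    filter_upwards [hψ2.coeFn_toLp] with x h1
    rw [h1, Complex.conj_conj]; ring
  rw [e3, e4] at key
  rw [e1, e2]
  linear_combination -key

theorem mem_sobolevH_iff (k : ℕ) (f : L2) : f ∈ sobolevH k ↔
    ∃ w : L2, TemperedDistribution.besselPotential ℝ ℂ k (toDistr f) = toDistr w := Iff.rfl

theorem mem_sobolevH_add_two_iff (k : ℕ) (f : L2) :
    f ∈ sobolevH (k + 2) ↔ ∃ w ∈ sobolevH k, opJ w = f := by
  constructor
  · intro hf
    have h2 : TemperedDistribution.MemSobolev 2 2 (toDistr f) :=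
      TemperedDistribution.MemSobolev.mono (s := ((k + 2 : ℕ) : ℝ))
        (by push_cast; linarith [Nat.cast_nonneg (α := ℝ) k]) hf
    obtain ⟨w, hw⟩ := h2
    refine ⟨w, ?_, ?_⟩
    · change TemperedDistribution.MemSobolev (k : ℝ) 2 (Lp.toTemperedDistribution w)
      rw [← hw, TemperedDistribution.memSobolev_besselPotential_iff]
      have : ((2 : ℝ) + k) = ((k + 2 : ℕ) : ℝ) := by push_cast; ring
      rw [this]; exact hf
    · apply toDistr_injective
      rw [toDistr_opJ, TemperedDistribution.besselPotential_neg_apply_eq_iff, hw]; rfl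
  · rintro ⟨w, hw, rfl⟩
    change TemperedDistribution.MemSobolev ((k + 2 : ℕ) : ℝ) 2 (toDistr (opJ w))
    rw [toDistr_opJ, TemperedDistribution.memSobolev_besselPotential_iff]
    have : ((-2 : ℝ) + ((k + 2 : ℕ) : ℝ)) = k := by push_cast; ring
    rw [this]; exact hw

theorem mem_sobolevH_zero (f : L2) : f ∈ sobolevH 0 := by
  rw [mem_sobolevH_iff]
  exact ⟨f, by simp⟩

theorem mem_sobolevH_two_iff (f : L2) : f ∈ sobolevH 2 ↔ ∃ w, opJ w = f := by
  rw [mem_sobolevH_add_two_iff 0]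
  simp [mem_sobolevH_zero]

theorem mem_sobolevH_four_iff (f : L2) : f ∈ sobolevH 4 ↔ ∃ w, opJ (opJ w) = f := by
  rw [mem_sobolevH_add_two_iff 2]
  simp only [mem_sobolevH_two_iff]
  constructor
  · rintro ⟨_, ⟨w, rfl⟩, rfl⟩; exact ⟨w, rfl⟩
  · rintro ⟨w, rfl⟩; exact ⟨_, ⟨w, rfl⟩, rfl⟩

/-- Elliptic regularity for `∂ₓ²`. -/
theorem eq_opJ_of_mem {f g h : L2} (hf : (f, g) ∈ dX.graph) (hg : (g, h) ∈ dX.graph) :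
    f = opJ (f - ((4 * Real.pi ^ 2 : ℝ) : ℂ)⁻¹ • h) := by
  have hpi : ((4 * Real.pi ^ 2 : ℝ) : ℂ) ≠ 0 := by
    exact_mod_cast (by positivity : (4 * Real.pi ^ 2 : ℝ) ≠ 0)
  have h1 : opJ h = opDD f := by rw [← opD_eq_of_mem hg, opD_eq_opDD_of_mem hf]
  rw [map_sub, map_smul, h1, opDD_apply, smul_smul, inv_mul_cancel₀ hpi, one_smul]
  abel

theorem mem_sobolevH_two_iff_dX (f : L2) :
    f ∈ sobolevH 2 ↔ ∃ g h, (f, g) ∈ dX.graph ∧ (g, h) ∈ dX.graph := by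
  rw [mem_sobolevH_two_iff]
  constructor
  · rintro ⟨w, rfl⟩
    exact ⟨_, _, opJ_opD_mem w, opD_opDD_mem w⟩
  · rintro ⟨g, h, hf, hg⟩
    exact ⟨_, (eq_opJ_of_mem hf hg).symm⟩

theorem mem_sobolevH_four_of_dX {f g h : L2} (hf : (f, g) ∈ dX.graph) (hg : (g, h) ∈ dX.graph)
    (hh : h ∈ sobolevH 2) : f ∈ sobolevH 4 := by
  have hf2 : f ∈ sobolevH 2 := (mem_sobolevH_two_iff_dX f).2 ⟨g, h, hf, hg⟩
  rw [mem_sobolevH_add_two_iff 2]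
  exact ⟨_, (sobolevH 2).sub_mem hf2 ((sobolevH 2).smul_mem _ hh), (eq_opJ_of_mem hf hg).symm⟩

theorem isClosed_dX_graph : IsClosed (dX.graph : Set (L2 × L2)) := by
  have : (dX.graph : Set (L2 × L2)) = {p | opD p.1 = opJ p.2} := by
    ext p; exact mem_dX_iff p.1 p.2
  rw [this]
  exact isClosed_eq (opD.continuous.comp continuous_fst) (opJ.continuous.comp continuous_snd)

/-- Derivatives of `H²(ℝ)` functions are dense in `H¹(ℝ)`. -/
theorem mem_closure_opD_opDD {u v : L2} (h : (u, v) ∈ dX.graph) :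
    (u, v) ∈ closure (Set.range fun w : L2 => (opD w, opDD w)) := by
  -- The `ℓ²` product norm gives a Hilbert space, so `(u, v)` can be projected onto the closure of
  -- the range. The orthogonal remainder `z` still lies in the closed graph of `∂ₓ`.
  let e := WithLp.prodContinuousLinearEquiv 2 ℂ L2 L2
  let T : L2 →L[ℂ] WithLp 2 (L2 × L2) :=
    (e.symm : (L2 × L2) →L[ℂ] WithLp 2 (L2 × L2)) ∘L (opD.prod opDD)
  let K := T.range.topologicalClosure
  have : CompleteSpace K := T.range.isClosed_topologicalClosure.completeSpace_coe
  have hKG : ∀ x ∈ K, e x ∈ dX.graph := by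
    intro x hx
    have hcl : IsClosed {x | e x ∈ dX.graph} := isClosed_dX_graph.preimage e.continuous
    refine closure_minimal ?_ hcl hx
    rintro _ ⟨w, rfl⟩
    exact opD_opDD_mem w
  obtain ⟨y, hy, z, hz, hyz⟩ := K.exists_add_mem_mem_orthogonal (e.symm (u, v))
  have hzG : (z.fst, z.snd) ∈ dX.graph := by
    have h1 : e z = (u, v) - e y := by
      rw [eq_sub_iff_add_eq, add_comm, ← map_add, ← hyz]; simp
    have h2 : e z ∈ dX.graph := by rw [h1]; exact dX.graph.sub_mem h (hKG y hy)
    exact h2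
  have hz0 : ∀ w, ⟪opD w, z.fst⟫_ℂ + ⟪opDD w, z.snd⟫_ℂ = 0 := by
    intro w
    have := hz (T w) (T.range.le_topologicalClosure ⟨w, rfl⟩)
    rw [WithLp.prod_inner_apply] at this
    exact this
  have hpi : ((4 * Real.pi ^ 2 : ℝ) : ℂ) ≠ 0 := by
    exact_mod_cast (by positivity : (4 * Real.pi ^ 2 : ℝ) ≠ 0)
  -- Orthogonality to all `(∂J w, ∂²J w)`, with `z.snd` the derivative of `z.fst`, says `J (∂² - 1)
  -- z.snd = 0`, and `∂² - 1` has no kernel in `L²`.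
  have hz1 : opDD z.snd = opJ z.snd := by
    refine ext_inner_left ℂ fun w => ?_
    have h1 := hz0 w
    have h2 := inner_opD w z.fst
    rw [opD_eq_of_mem hzG] at h2
    rw [h2, opDD_apply]
    rw [opDD_apply, inner_smul_left, Complex.conj_ofReal, inner_sub_left, ← inner_opJ] at h1
    rw [inner_smul_right, inner_sub_right]
    linear_combination h1
  have hz2 : z.snd = 0 := by
    have h1 : ((4 * Real.pi ^ 2 : ℝ) : ℂ) • z.snd =
        ((4 * Real.pi ^ 2 - 1 : ℝ) : ℂ) • opJ z.snd := by
      rw [opDD_apply, smul_sub, sub_eq_iff_eq_add, ← sub_eq_iff_eq_add'] at hz1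
      rw [Complex.ofReal_sub, sub_smul, Complex.ofReal_one, one_smul, hz1]
    have h2 := congrArg norm h1
    rw [norm_smul, norm_smul, Complex.norm_real, Complex.norm_real, Real.norm_eq_abs,
      Real.norm_eq_abs] at h2
    have h3 : 1 < 4 * Real.pi ^ 2 := by nlinarith [Real.pi_gt_three]
    rw [abs_of_pos (by linarith), abs_of_pos (by linarith)] at h2
    have h4 := norm_opJ_le z.snd
    have h5 : ‖z.snd‖ = 0 := by nlinarith [norm_nonneg z.snd]
    exact norm_eq_zero.1 h5
  have hz3 : z.fst = 0 := eq_zero_of_dX_zero (hz2 ▸ hzG)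
  have hz4 : z = 0 := by
    apply e.injective
    exact Prod.ext hz3 hz2
  have hmem : e.symm (u, v) ∈ K := by rw [hyz, hz4, add_zero]; exact hy
  have h5 : e (e.symm (u, v)) ∈ closure (e '' (T.range : Set (WithLp 2 (L2 × L2)))) :=
    mem_closure_image e.continuous.continuousAt hmem
  rw [e.apply_symm_apply] at h5
  refine closure_mono ?_ h5
  rintro _ ⟨_, ⟨w, rfl⟩, rfl⟩
  exact ⟨w, rfl⟩

end Derivative

/-! ### Coercivity on a hyperplane and the negative spectrum of a symmetric pencil. -/

section Abstract
variable {H : Type*} [NormedAddCommGroup H] [InnerProductSpace ℂ H]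

/-- Lax–Milgram for a bounded operator that is coercive on a closed subspace `K`. -/
theorem exists_sub_mem_orthogonal_of_coercive (B : H →L[ℂ] H) (K : Submodule ℂ H)
    [CompleteSpace K] {δ : ℝ} (hδ : 0 < δ)
    (hB : ∀ w ∈ K, δ * ‖w‖ ^ 2 ≤ ‖⟪w, B w⟫_ℂ‖) (h : H) :
    ∃ f ∈ K, h - B f ∈ Kᗮ := by
  let T : K →L[ℂ] K := K.orthogonalProjectionOnto ∘L B ∘L K.subtypeL
  have hT : ∀ w v : K, ⟪v, T w⟫_ℂ = ⟪(v : H), B w⟫_ℂ := fun w v => by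
    simp [T]
  have hbelow : ∀ w : K, δ * ‖w‖ ≤ ‖T w‖ := by
    intro w
    rcases eq_or_ne w 0 with rfl | hw
    · simp
    have hw' : 0 < ‖w‖ := norm_pos_iff.mpr hw
    have h1 := hB w w.2
    rw [← hT] at h1
    have h2 := norm_inner_le_norm (𝕜 := ℂ) w (T w)
    have h3 : ‖(w : H)‖ = ‖w‖ := rfl
    rw [h3] at h1
    nlinarith
  have hanti : AntilipschitzWith (Real.toNNReal δ⁻¹) T := by
    refine ContinuousLinearMap.antilipschitz_of_bound T ?_
    intro w
    rw [Real.coe_toNNReal _ (inv_pos.mpr hδ).le, ← div_eq_inv_mul, le_div_iff₀ hδ, mul_comm]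
    exact hbelow w
  have hclosed : IsClosed (T.range : Set K) := hanti.isClosed_range T.uniformContinuous
  have hcomp : CompleteSpace T.range := hclosed.completeSpace_coe
  have htop : T.range = ⊤ := by
    rw [← T.range.orthogonal_orthogonal, Submodule.eq_top_iff']
    intro v w hw
    have h0 : ⟪T w, w⟫_ℂ = 0 := hw _ ⟨w, rfl⟩
    have h1 : ⟪w, T w⟫_ℂ = 0 := by rw [← inner_conj_symm, h0, map_zero]
    have h2 := hB w w.2
    rw [← hT, h1, norm_zero] at h2
    have h3 : ‖(w : H)‖ ^ 2 ≤ 0 := by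
      by_contra hc
      push Not at hc
      nlinarith
    have h4 : ‖(w : H)‖ = 0 := by nlinarith [sq_nonneg ‖(w : H)‖]
    have : w = 0 := by
      rw [norm_eq_zero] at h4
      exact_mod_cast h4
    rw [this, inner_zero_left]
  obtain ⟨f, hf⟩ : ∃ f : K, T f = K.orthogonalProjectionOnto h := by
    have : K.orthogonalProjectionOnto h ∈ T.range := htop ▸ Submodule.mem_top
    exact this
  refine ⟨f, f.2, ?_⟩
  intro u hu
  have h1 := hT f ⟨u, hu⟩
  rw [hf] at h1
  rw [inner_sub_right, ← h1]
  simp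

/-- Coercivity on `k^⊥` solves every equation up to a multiple of `k`, so it remains to reach `k`.
Solving with right-hand side `B k` gives `B (k - f) = s • k` with `f ⊥ k`; if `s = 0`, injectivity
forces `k = f ⊥ k`, that is, `k = 0`. -/
theorem surjective_of_coercive_hyperplane [CompleteSpace H] (B : H →L[ℂ] H) (k : H)
    {δ : ℝ} (hδ : 0 < δ) (hB : ∀ w, ⟪k, w⟫_ℂ = 0 → δ * ‖w‖ ^ 2 ≤ ‖⟪w, B w⟫_ℂ‖)
    (hinj : ∀ w, B w = 0 → w = 0) : Function.Surjective B := by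
  let K : Submodule ℂ H := (ℂ ∙ k)ᗮ
  have hK : ∀ w, w ∈ K ↔ ⟪k, w⟫_ℂ = 0 := fun w => Submodule.mem_orthogonal_singleton_iff_inner_right
  have hB' : ∀ w ∈ K, δ * ‖w‖ ^ 2 ≤ ‖⟪w, B w⟫_ℂ‖ := fun w hw => hB w ((hK w).1 hw)
  have hsol : ∀ h, ∃ f, ∃ s : ℂ, f ∈ K ∧ h = B f + s • k := by
    intro h
    obtain ⟨f, hf, hfo⟩ := exists_sub_mem_orthogonal_of_coercive B K hδ hB' h
    have : h - B f ∈ (ℂ ∙ k) := by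
      have := hfo
      simpa [K, Submodule.orthogonal_orthogonal] using this
    obtain ⟨s, hs⟩ := Submodule.mem_span_singleton.1 this
    exact ⟨f, s, hf, by rw [hs]; abel⟩
  have hk : ∃ g, B g = k := by
    obtain ⟨f, s, hf, hs⟩ := hsol (B k)
    have h1 : B (k - f) = s • k := by rw [map_sub, hs]; abel
    by_cases h0 : s = 0
    · rw [h0, zero_smul] at h1
      have h2 := hinj _ h1
      have h3 : k = f := sub_eq_zero.1 h2
      rw [← h3, hK] at hf
      have : k = 0 := inner_self_eq_zero.1 hf
      exact ⟨0, by rw [this, map_zero]⟩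
    · exact ⟨s⁻¹ • (k - f), by rw [map_smul, h1, smul_smul, inv_mul_cancel₀ h0, one_smul]⟩
  obtain ⟨g, hg⟩ := hk
  intro h
  obtain ⟨f, s, -, hs⟩ := hsol h
  exact ⟨f + s • g, by rw [map_add, map_smul, hg, hs]⟩

/-- A nonnegative symmetric surjective bounded operator is coercive. -/
theorem exists_coercive_of_nonneg_surjective [CompleteSpace H] (B : H →L[ℂ] H)
    (hsymm : ∀ u v, ⟪u, B v⟫_ℂ = ⟪B u, v⟫_ℂ) (hnonneg : ∀ w, 0 ≤ (⟪w, B w⟫_ℂ).re)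
    (hsurj : Function.Surjective B) :
    ∃ δ > 0, ∀ w, δ * ‖w‖ ^ 2 ≤ (⟪w, B w⟫_ℂ).re := by
  obtain ⟨C, hC, hpre⟩ := B.exists_preimage_norm_le hsurj
  refine ⟨C⁻¹, inv_pos.2 hC, fun w => ?_⟩
  obtain ⟨v, rfl, hv⟩ := hpre w
  -- With `w = B v`, expanding gives `⟪w, B w⟫ - 2 C⁻¹ ‖w‖² + C⁻² ⟪v, B v⟫ ≥ 0`, while `⟪v, B v⟫ ≤ C
  -- ‖w‖²`.
  have h1 := hnonneg (B v - ((C⁻¹ : ℝ) : ℂ) • v)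
  have h2 : (⟪v, B v⟫_ℂ).re ≤ C * ‖B v‖ ^ 2 := by
    have := norm_inner_le_norm (𝕜 := ℂ) v (B v)
    have h3 := Complex.re_le_norm ⟪v, B v⟫_ℂ
    nlinarith [norm_nonneg (B v)]
  have h4 : (⟪B v, B v⟫_ℂ).re = ‖B v‖ ^ 2 := by
    rw [inner_self_eq_norm_sq_to_K]; norm_cast
  have h5 : ⟪v, B (B v)⟫_ℂ = ⟪B v, B v⟫_ℂ := hsymm _ _
  simp only [map_sub, map_smul, inner_sub_left, inner_sub_right, inner_smul_left,
    inner_smul_right, Complex.conj_ofReal, Complex.sub_re, Complex.re_ofReal_mul, h5, h4] at h1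
  have hC1 : C⁻¹ * C = 1 := inv_mul_cancel₀ hC.ne'
  have h6 : C⁻¹ * (C⁻¹ * (⟪v, B v⟫_ℂ).re) ≤ C⁻¹ * ‖B v‖ ^ 2 := by
    have : C⁻¹ * (⟪v, B v⟫_ℂ).re ≤ C⁻¹ * (C * ‖B v‖ ^ 2) := by gcongr
    rw [← mul_assoc, hC1, one_mul] at this
    gcongr
  linarith

/-- The operator `A - z J²`. -/
def pencil (A J : H →L[ℂ] H) (z : ℂ) : H →L[ℂ] H := A - z • (J ∘L J)

theorem pencil_apply (A J : H →L[ℂ] H) (z : ℂ) (w : H) :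
    pencil A J z w = A w - z • J (J w) := rfl

theorem inner_pencil (A J : H →L[ℂ] H) (hJ : ∀ u v, ⟪u, J v⟫_ℂ = ⟪J u, v⟫_ℂ) (z : ℂ) (u w : H) :
    ⟪u, pencil A J z w⟫_ℂ = ⟪u, A w⟫_ℂ - z * ⟪J u, J w⟫_ℂ := by
  rw [pencil_apply, inner_sub_right, inner_smul_right, hJ]

/-- For `z` not real the imaginary part gives `η = |Im z|`; for `z` negative the two terms add up
and `η = -z`. -/
theorem exists_mul_le_norm_sub_mul {z : ℂ} (hz : ¬ ∃ r : ℝ, 0 ≤ r ∧ z = r) :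
    ∃ η > 0, ∀ a n : ℝ, 0 ≤ a → 0 ≤ n → η * n ≤ ‖(a : ℂ) - z * n‖ := by
  by_cases him : z.im = 0
  · have hre : z.re < 0 := by
      by_contra h
      exact hz ⟨z.re, not_lt.1 h, Complex.ext rfl (by simp [him])⟩
    refine ⟨-z.re, by linarith, fun a n ha hn => ?_⟩
    have := Complex.re_le_norm ((a : ℂ) - z * n)
    simp at this
    linarith
  · refine ⟨|z.im|, abs_pos.2 him, fun a n ha hn => ?_⟩
    have := Complex.abs_im_le_norm ((a : ℂ) - z * n)
    simpa [abs_mul, abs_of_nonneg hn] using this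

/-- The spectral structure of a symmetric pencil with a Gårding inequality whose form is
nonnegative on a hyperplane and takes a negative value. -/
theorem exists_unique_negative_eigenvalue_pencil [CompleteSpace H] (A J : H →L[ℂ] H) (k : H)
    {δ C : ℝ} (hδ : 0 < δ) (hA : ∀ u v, ⟪u, A v⟫_ℂ = ⟪A u, v⟫_ℂ)
    (hJ : ∀ u v, ⟪u, J v⟫_ℂ = ⟪J u, v⟫_ℂ) (hJinj : ∀ w, J w = 0 → w = 0)
    (hgarding : ∀ w, δ * ‖w‖ ^ 2 ≤ (⟪w, A w⟫_ℂ).re + C * ‖J w‖ ^ 2)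
    (hk : ∀ w, ⟪k, w⟫_ℂ = 0 → 0 ≤ (⟪w, A w⟫_ℂ).re)
    (hneg : ∃ w, (⟪w, A w⟫_ℂ).re < 0) :
    ∃ l : ℝ, l < 0 ∧ Module.finrank ℂ (pencil A J l).ker = 1 ∧
      (∀ m : ℝ, m < 0 → (∃ w, w ≠ 0 ∧ pencil A J m w = 0) → m = l) ∧
      ∀ z : ℂ, (¬ ∃ r : ℝ, 0 ≤ r ∧ z = r) → z ≠ l → Function.Bijective (pencil A J z) := by
  set a : H → ℝ := fun w => (⟪w, A w⟫_ℂ).re with ha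
  have hareal : ∀ w, ⟪w, A w⟫_ℂ = (a w : ℂ) := fun w => by
    have : (starRingEnd ℂ) ⟪w, A w⟫_ℂ = ⟪w, A w⟫_ℂ := by rw [inner_conj_symm, hA]
    exact (Complex.conj_eq_iff_re.1 this).symm
  have hJJ : ∀ w, ⟪J w, J w⟫_ℂ = ((‖J w‖ ^ 2 : ℝ) : ℂ) := fun w => by
    rw [inner_self_eq_norm_sq_to_K]; norm_cast
  have hpen : ∀ (z : ℂ) w, ⟪w, pencil A J z w⟫_ℂ = (a w : ℂ) - z * ((‖J w‖ ^ 2 : ℝ) : ℂ) :=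
    fun z w => by rw [inner_pencil A J hJ, hareal, hJJ]
  have hn0 : ∀ w, w ≠ 0 → 0 < ‖J w‖ ^ 2 := fun w hw => by
    have : J w ≠ 0 := fun h => hw (hJinj w h)
    positivity
  -- coercivity on the hyperplane
  have hcoer : ∀ z : ℂ, (¬ ∃ r : ℝ, 0 ≤ r ∧ z = r) → ∃ ε > 0, ∀ w, ⟪k, w⟫_ℂ = 0 →
      ε * ‖w‖ ^ 2 ≤ ‖⟪w, pencil A J z w⟫_ℂ‖ := by
    intro z hz
    obtain ⟨η, hη, hηle⟩ := exists_mul_le_norm_sub_mul hz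
    have hD : 0 < 1 + (‖z‖ + |C|) / η := by positivity
    -- Let `E` be the modulus of the pencil's form. Then `‖J w‖² ≤ E / η` and `a w ≤ E + ‖z‖ ‖J
    -- w‖²`; Gårding's inequality turns these into `δ ‖w‖² ≤ E (1 + (‖z‖ + |C|) / η)`.
    refine ⟨δ / (1 + (‖z‖ + |C|) / η), div_pos hδ hD, fun w hw => ?_⟩
    have h1 := hηle (a w) (‖J w‖ ^ 2) (hk w hw) (by positivity)
    rw [← hpen] at h1
    set E := ‖⟪w, pencil A J z w⟫_ℂ‖ with hE
    have h2 : a w ≤ E + ‖z‖ * ‖J w‖ ^ 2 := by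
      have h3 : (a w : ℂ) = ⟪w, pencil A J z w⟫_ℂ + z * ((‖J w‖ ^ 2 : ℝ) : ℂ) := by
        rw [hpen]; ring
      have h4 := norm_add_le ⟪w, pencil A J z w⟫_ℂ (z * ((‖J w‖ ^ 2 : ℝ) : ℂ))
      rw [← h3, norm_mul, Complex.norm_real, Complex.norm_real, Real.norm_eq_abs,
        Real.norm_eq_abs, abs_of_nonneg (sq_nonneg ‖J w‖)] at h4
      exact (le_abs_self _).trans h4
    have h3 := hgarding w
    have h4 : ‖J w‖ ^ 2 ≤ E / η := by rw [le_div_iff₀ hη]; linarith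
    have h5 : C * ‖J w‖ ^ 2 ≤ |C| * ‖J w‖ ^ 2 := by gcongr; exact le_abs_self C
    have h6 : (‖z‖ + |C|) * ‖J w‖ ^ 2 ≤ (‖z‖ + |C|) * (E / η) := by gcongr
    rw [div_mul_eq_mul_div, div_le_iff₀ hD]
    have h7 : E * (1 + (‖z‖ + |C|) / η) = E + (‖z‖ + |C|) * (E / η) := by ring
    rw [h7]
    change δ * ‖w‖ ^ 2 ≤ a w + C * ‖J w‖ ^ 2 at h3
    linarith
  have hker : ∀ z : ℂ, (¬ ∃ r : ℝ, 0 ≤ r ∧ z = r) → ∀ w, pencil A J z w = 0 → ⟪k, w⟫_ℂ = 0 →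
      w = 0 := by
    intro z hz w hw hkw
    obtain ⟨ε, hε, hle⟩ := hcoer z hz
    have := hle w hkw
    rw [hw, inner_zero_right, norm_zero] at this
    by_contra hne
    have : 0 < ε * ‖w‖ ^ 2 := by have := norm_pos_iff.2 hne; positivity
    linarith
  have hbij : ∀ z : ℂ, (¬ ∃ r : ℝ, 0 ≤ r ∧ z = r) → (∀ w, pencil A J z w = 0 → w = 0) →
      Function.Bijective (pencil A J z) := by
    intro z hz hinj
    obtain ⟨ε, hε, hle⟩ := hcoer z hz
    exact ⟨(injective_iff_map_eq_zero _).2 hinj,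
      surjective_of_coercive_hyperplane _ k hε hle hinj⟩
  have hnegreal : ∀ m : ℝ, m < 0 → ¬ ∃ r : ℝ, 0 ≤ r ∧ (m : ℂ) = r := by
    rintro m hm ⟨r, hr, h⟩
    have : m = r := by exact_mod_cast h
    linarith
  -- the bottom of the spectrum
  let S : Set ℝ := {r | ∃ w, w ≠ 0 ∧ r = a w / ‖J w‖ ^ 2}
  have hSbdd : BddBelow S := by
    refine ⟨-C, ?_⟩
    rintro r ⟨w, hw, rfl⟩
    rw [le_div_iff₀ (hn0 w hw)]
    have h3 := hgarding w
    have : 0 ≤ δ * ‖w‖ ^ 2 := by positivity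
    change δ * ‖w‖ ^ 2 ≤ a w + C * ‖J w‖ ^ 2 at h3
    linarith
  obtain ⟨w0, hw0⟩ := hneg
  have hw0ne : w0 ≠ 0 := by rintro rfl; simp at hw0
  have hSne : S.Nonempty := ⟨_, w0, hw0ne, rfl⟩
  set l := sInf S with hl
  have hl0 : l < 0 := lt_of_le_of_lt (csInf_le hSbdd ⟨w0, hw0ne, rfl⟩)
    (div_neg_of_neg_of_pos hw0 (hn0 w0 hw0ne))
  have hal : ∀ w, l * ‖J w‖ ^ 2 ≤ a w := by
    intro w
    rcases eq_or_ne w 0 with rfl | hw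
    · simp [ha]
    · exact (le_div_iff₀ (hn0 w hw)).1 (csInf_le hSbdd ⟨w, hw, rfl⟩)
  have hpenre : ∀ (m : ℝ) w, (⟪w, pencil A J m w⟫_ℂ).re = a w - m * ‖J w‖ ^ 2 := fun m w => by
    rw [hpen]; simp only [Complex.sub_re, Complex.ofReal_re, Complex.re_ofReal_mul]
  have hpensymm : ∀ (m : ℝ) u v, ⟪u, pencil A J m v⟫_ℂ = ⟪pencil A J m u, v⟫_ℂ := fun m u v => by
    rw [inner_pencil A J hJ, pencil_apply, inner_sub_left, inner_smul_left, hA, hJ,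
      Complex.conj_ofReal]
  -- Otherwise the pencil at `l` is bijective and nonnegative, hence coercive with some `ε`, and
  -- every Rayleigh quotient is at least `l + ε / (‖J‖ + 1)²`.
  have heig : ∃ w, w ≠ 0 ∧ pencil A J l w = 0 := by
    by_contra hcon
    push Not at hcon
    have hinj : ∀ w, pencil A J l w = 0 → w = 0 := fun w hw => by
      by_contra h; exact hcon w h hw
    obtain ⟨ε, hε, hle⟩ := exists_coercive_of_nonneg_surjective (pencil A J l) (hpensymm l)
      (fun w => by rw [hpenre]; linarith [hal w]) (hbij l (hnegreal l hl0) hinj).2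
    have hJn : ∀ w, ‖J w‖ ^ 2 ≤ (‖J‖ + 1) ^ 2 * ‖w‖ ^ 2 := fun w => by
      rw [← mul_pow]
      have := J.le_opNorm w
      gcongr
      nlinarith [norm_nonneg w]
    have hD : 0 < (‖J‖ + 1) ^ 2 := by positivity
    have hlow : l + ε / (‖J‖ + 1) ^ 2 ≤ sInf S := by
      refine le_csInf hSne ?_
      rintro r ⟨w, hw, rfl⟩
      rw [le_div_iff₀ (hn0 w hw)]
      have h1 := hle w
      rw [hpenre] at h1
      have h2 : ε / (‖J‖ + 1) ^ 2 * ‖J w‖ ^ 2 ≤ ε * ‖w‖ ^ 2 := by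
        rw [div_mul_eq_mul_div, div_le_iff₀ hD]
        nlinarith [hJn w]
      linarith
    have : 0 < ε / (‖J‖ + 1) ^ 2 := by positivity
    linarith
  obtain ⟨e, he, hBe⟩ := heig
  have hke : ⟪k, e⟫_ℂ ≠ 0 := fun h => he (hker l (hnegreal l hl0) e hBe h)
  have huniq : ∀ m : ℝ, m < 0 → (∃ w, w ≠ 0 ∧ pencil A J m w = 0) → m = l := by
    rintro m hm ⟨w, hw, hBw⟩
    by_contra hne
    have hAe : A e = (l : ℂ) • J (J e) := by rwa [pencil_apply, sub_eq_zero] at hBe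
    have hAw : A w = (m : ℂ) • J (J w) := by rwa [pencil_apply, sub_eq_zero] at hBw
    have horth : ⟪J e, J w⟫_ℂ = 0 := by
      have h1 : ⟪e, A w⟫_ℂ = m * ⟪J e, J w⟫_ℂ := by rw [hAw, inner_smul_right, hJ]
      have h2 : ⟪e, A w⟫_ℂ = l * ⟪J e, J w⟫_ℂ := by
        rw [hA, hAe, inner_smul_left, Complex.conj_ofReal, ← hJ (J e)]
      have h3 : ((m : ℂ) - l) * ⟪J e, J w⟫_ℂ = 0 := by rw [sub_mul, ← h1, ← h2, sub_self]
      rcases mul_eq_zero.1 h3 with h | h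
      · exact absurd (by exact_mod_cast sub_eq_zero.1 h) hne
      · exact h
    have horth' : ⟪J w, J e⟫_ℂ = 0 := by rw [← inner_conj_symm, horth, map_zero]
    set α := ⟪k, w⟫_ℂ
    set β := ⟪k, e⟫_ℂ
    -- This combination lies in the hyperplane. As `J e ⊥ J w`, its form is `l |α|² ‖J e‖² + m |β|²
    -- ‖J w‖²`, which is negative because `β ≠ 0`.
    have h0 := hk (α • e - β • w) (by
      rw [inner_sub_right, inner_smul_right, inner_smul_right]; ring)
    have h1 : ⟪α • e - β • w, A (α • e - β • w)⟫_ℂ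
        = ((‖α‖ ^ 2 * (l * ‖J e‖ ^ 2) + ‖β‖ ^ 2 * (m * ‖J w‖ ^ 2) : ℝ) : ℂ) := by
      simp only [map_sub, map_smul, hAe, hAw, inner_sub_left, inner_sub_right, inner_smul_left,
        inner_smul_right, hJ _ (J _), horth, horth', hJJ]
      have e1 := Complex.conj_mul' α
      have e2 := Complex.conj_mul' β
      push_cast
      linear_combination (l * (‖J e‖ : ℂ) ^ 2) * e1 + (m * (‖J w‖ : ℂ) ^ 2) * e2
    rw [h1, Complex.ofReal_re] at h0
    have h2 : 0 < ‖β‖ ^ 2 := by have := norm_pos_iff.2 hke; positivity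
    have h3 := mul_pos h2 (hn0 w hw)
    have h4 : 0 ≤ ‖α‖ ^ 2 * ‖J e‖ ^ 2 := by positivity
    nlinarith
  refine ⟨l, hl0, ?_, huniq, ?_⟩
  · refine finrank_eq_one_iff'.2 ⟨⟨e, hBe⟩, fun h => he (congrArg Subtype.val h), ?_⟩
    rintro ⟨w, hw⟩
    have hw' : pencil A J l w = 0 := hw
    -- The coefficient is chosen so that the difference falls in the hyperplane, where the kernel is
    -- trivial.
    refine ⟨⟪k, w⟫_ℂ / ⟪k, e⟫_ℂ, Subtype.ext ?_⟩
    have := hker l (hnegreal l hl0) ((⟪k, w⟫_ℂ / ⟪k, e⟫_ℂ) • e - w)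
      (by rw [map_sub, map_smul, hBe, hw', smul_zero, sub_zero])
      (by rw [inner_sub_right, inner_smul_right]; field_simp; simp)
    exact sub_eq_zero.1 this
  · intro z hz hzl
    refine hbij z hz fun w hw => ?_
    by_contra hne
    -- A kernel vector makes `z` its own Rayleigh quotient, hence real, hence negative.
    have h1 : (a w : ℂ) - z * ((‖J w‖ ^ 2 : ℝ) : ℂ) = 0 := by
      rw [← hpen, hw, inner_zero_right]
    have hz' : z = ((a w / ‖J w‖ ^ 2 : ℝ) : ℂ) := by
      have : ((‖J w‖ ^ 2 : ℝ) : ℂ) ≠ 0 := by exact_mod_cast (hn0 w hne).ne'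
      rw [Complex.ofReal_div, eq_div_iff this]
      linear_combination -h1
    set m := a w / ‖J w‖ ^ 2
    have hm : m < 0 := by
      by_contra h
      exact hz ⟨m, not_lt.1 h, hz'⟩
    rw [hz'] at hw
    exact hzl (by rw [hz', huniq m hm ⟨w, hne, hw⟩])

end Abstract

/-! ### First integrals of the solitary wave equation. -/

theorem eq_zero_of_tendsto_sq_deriv {f f' : ℝ → ℝ} {l : ℝ} (hd : ∀ x, HasDerivAt f (f' x) x)
    (hf : Tendsto f atTop (𝓝 0)) (hf' : Tendsto (fun x => f' x ^ 2) atTop (𝓝 l)) : l = 0 := by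
  -- The mean value theorem supplies points going to infinity along which `f'` tends to `0`.
  have hex : ∀ x : ℝ, ∃ ξ, x < ξ ∧ f' ξ = f (x + 1) - f x := by
    intro x
    obtain ⟨ξ, hξ, h⟩ := exists_hasDerivAt_eq_slope f f' (by linarith : x < x + 1)
      (fun y _ => (hd y).continuousAt.continuousWithinAt) (fun y _ => hd y)
    exact ⟨ξ, hξ.1, by rw [h]; simp⟩
  choose ξ hξ hfξ using hex
  have h1 : Tendsto ξ atTop atTop := tendsto_atTop_mono (fun x => (hξ x).le) tendsto_id
  have h2 := hf'.comp h1
  have h3 : Tendsto (fun x => (f (x + 1) - f x) ^ 2) atTop (𝓝 ((0 - 0) ^ 2)) :=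
    ((hf.comp (tendsto_atTop_add_const_right _ 1 tendsto_id)).sub hf).pow 2
  have h4 : ((fun x => f' x ^ 2) ∘ ξ) = fun x => (f (x + 1) - f x) ^ 2 := by
    ext x; simp [hfξ]
  rw [h4] at h2
  simpa using tendsto_nhds_unique h2 h3

/-- The first integrals and the bounds satisfied by a solitary wave profile. -/
structure IsProfile (κ c : ℝ) (Q Q1 Q2 Q3 : ℝ → ℝ) : Prop where
  hκ : 0 < κ
  hc : 2 * κ < c
  d0 : ∀ x, HasDerivAt Q (Q1 x) x
  d1 : ∀ x, HasDerivAt Q1 (Q2 x) x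
  d2 : ∀ x, HasDerivAt Q2 (Q3 x) x
  cont3 : Continuous Q3
  lim : Tendsto Q (cocompact ℝ) (𝓝 0)
  pos : ∀ x, 0 < Q x
  le : ∀ x, Q x ≤ c - 2 * κ
  first : ∀ x, (c - Q x) * Q1 x ^ 2 = Q x ^ 2 * (c - 2 * κ - Q x)
  second : ∀ x, (c - Q x) * Q2 x = Q1 x ^ 2 / 2 - 3 / 2 * Q x ^ 2 + (c - 2 * κ) * Q x
  third : ∀ x, (c - Q x) * Q3 x = 2 * Q1 x * Q2 x - 3 * Q x * Q1 x + (c - 2 * κ) * Q1 x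

/-- Grönwall: `f² exp(-2Kx)` decreases and `f² exp(2Kx)` increases, so a zero propagates both ways.
-/
theorem eq_zero_of_abs_deriv_le {f f' : ℝ → ℝ} {K : ℝ} (hd : ∀ x, HasDerivAt f (f' x) x)
    (hK : ∀ x, |f' x| ≤ K * |f x|) {x₀ : ℝ} (h0 : f x₀ = 0) (x : ℝ) : f x = 0 := by
  have hexp : ∀ m x : ℝ, HasDerivAt (fun x => f x ^ 2 * Real.exp (m * x))
      ((2 * (f x * f' x) + m * f x ^ 2) * Real.exp (m * x)) x := by
    intro m x
    have h1 : HasDerivAt (fun x => Real.exp (m * x)) (Real.exp (m * x) * m) x := by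
      simpa using ((hasDerivAt_id x).const_mul m).exp
    refine (((hd x).pow 2).mul h1).congr_deriv ?_
    simp; ring
  have hb : ∀ x, |f x * f' x| ≤ K * f x ^ 2 := fun x => by
    rw [abs_mul, ← sq_abs (f x)]
    nlinarith [hK x, abs_nonneg (f x)]
  have hz : ∀ m, f x ^ 2 * Real.exp (m * x) ≤ 0 → f x = 0 := fun m h => by
    have h1 := Real.exp_pos (m * x)
    have h2 : f x ^ 2 ≤ 0 := by
      by_contra h3
      push Not at h3
      have := mul_pos h3 h1
      linarith
    exact pow_eq_zero_iff two_ne_zero |>.1 (le_antisymm h2 (sq_nonneg _))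
  rcases le_total x₀ x with hx | hx
  · have : Antitone (fun x => f x ^ 2 * Real.exp (-(2 * K) * x)) := by
      refine antitone_of_hasDerivAt_nonpos (fun x => hexp _ x) fun x => ?_
      have := (abs_le.1 (hb x)).2
      exact mul_nonpos_of_nonpos_of_nonneg (by linarith) (Real.exp_pos _).le
    refine hz _ ((this hx).trans ?_)
    simp [h0]
  · have : Monotone (fun x => f x ^ 2 * Real.exp ((2 * K) * x)) := by
      refine monotone_of_hasDerivAt_nonneg (fun x => hexp _ x) fun x => ?_
      have := (abs_le.1 (hb x)).1
      exact mul_nonneg (by linarith) (Real.exp_pos _).le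
    refine hz _ ((this hx).trans ?_)
    simp [h0]

theorem eq_const_of_hasDerivAt_zero {f : ℝ → ℝ} (h : ∀ x, HasDerivAt f 0 x) (x : ℝ) :
    f x = f 0 :=
  is_const_of_deriv_eq_zero (fun x => (h x).differentiableAt) (fun x => (h x).deriv) x 0

theorem IsSolitaryWave.isProfile {κ c : ℝ} (hκ : 0 < κ) (hc : 2 * κ < c) {Q : ℝ → ℝ}
    (h : IsSolitaryWave κ c Q) :
    IsProfile κ c Q (deriv Q) (iteratedDeriv 2 Q) (iteratedDeriv 3 Q) := by
  have hd : ∀ n : ℕ, n < 3 → ∀ x,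
      HasDerivAt (iteratedDeriv n Q) (iteratedDeriv (n + 1) Q x) x := fun n hn x => by
    rw [iteratedDeriv_succ]
    exact (h.contDiff.differentiable_iteratedDeriv n (by exact_mod_cast hn) x).hasDerivAt
  have d0 : ∀ x, HasDerivAt Q (deriv Q x) x := fun x => by
    simpa [iteratedDeriv_zero, iteratedDeriv_one] using hd 0 (by norm_num) x
  have d1 : ∀ x, HasDerivAt (deriv Q) (iteratedDeriv 2 Q x) x := fun x => by
    simpa [iteratedDeriv_one] using hd 1 (by norm_num) x
  have d2 := hd 2 (by norm_num)
  have hcont3 : Continuous (iteratedDeriv 3 Q) := h.contDiff.continuous_iteratedDeriv 3 le_rfl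
  have hcont : Continuous Q := continuous_iff_continuousAt.2 fun x => (d0 x).continuousAt
  have hode : ∀ x, -c * deriv Q x + c * iteratedDeriv 3 Q x + 3 * Q x * deriv Q x
      + 2 * κ * deriv Q x - 2 * deriv Q x * iteratedDeriv 2 Q x
      - Q x * iteratedDeriv 3 Q x = 0 := by
    intro x
    have h1 := h.isCHSolution 0 x
    have h2 : ∀ y, deriv (fun s => Q (y - c * s)) 0 = -c * deriv Q y := fun y => by
      have h3 : HasDerivAt (fun s => y - c * s) (-c) (0 : ℝ) := by
        simpa using ((hasDerivAt_id (0 : ℝ)).const_mul c).const_sub y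
      have h4 : HasDerivAt Q (deriv Q y) (y - c * 0) := by simpa using d0 y
      have h7 : deriv (fun s => Q (y - c * s)) 0 = _ := (h4.comp (0 : ℝ) h3).deriv
      rw [h7]; ring
    have h5 : iteratedDeriv 2 (fun y => -c * deriv Q y) x = -c * iteratedDeriv 3 Q x := by
      rw [iteratedDeriv_succ', iteratedDeriv_one]
      have h6 : deriv (fun y => -c * deriv Q y) = fun y => -c * iteratedDeriv 2 Q y := by
        ext y; exact ((d1 y).const_mul (-c)).deriv
      rw [h6]
      exact ((d2 x).const_mul (-c)).deriv
    simp only [h2, h5] at h1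
    simp only [mul_zero, sub_zero] at h1
    change -c * deriv Q x - -c * iteratedDeriv 3 Q x + 3 * Q x * deriv Q x + 2 * κ * deriv Q x
      - 2 * deriv Q x * iteratedDeriv 2 Q x - Q x * iteratedDeriv 3 Q x = 0 at h1
    linarith
  set Q1 := deriv Q
  set Q2 := iteratedDeriv 2 Q
  set Q3 := iteratedDeriv 3 Q
  have htop : Tendsto Q atTop (𝓝 0) := h.tendsto_zero.mono_left atTop_le_cocompact
  have hc0 : c ≠ 0 := by linarith
  -- first integral
  obtain ⟨A, hA⟩ : ∃ A, ∀ x, (c - Q x) * Q2 x - Q1 x ^ 2 / 2 + 3 / 2 * Q x ^ 2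
      - (c - 2 * κ) * Q x = A := by
    refine ⟨_, fun x => eq_const_of_hasDerivAt_zero (f := fun x => (c - Q x) * Q2 x - Q1 x ^ 2 / 2
      + 3 / 2 * Q x ^ 2 - (c - 2 * κ) * Q x) (fun x => ?_) x⟩
    have := (((((d0 x).const_sub c).mul (d2 x)).sub (((d1 x).pow 2).div_const 2)).add
      (((d0 x).pow 2).const_mul (3 / 2))).sub ((d0 x).const_mul (c - 2 * κ))
    refine this.congr_deriv ?_
    simp only [Nat.cast_ofNat]
    linear_combination hode x
  -- The derivative of this expression is `2 Q'` times the first integral, so it is constant too.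
  obtain ⟨B, hB⟩ : ∃ B, ∀ x, (c - Q x) * Q1 x ^ 2 + Q x ^ 3 - (c - 2 * κ) * Q x ^ 2
      - 2 * A * Q x = B := by
    refine ⟨_, fun x => eq_const_of_hasDerivAt_zero (f := fun x => (c - Q x) * Q1 x ^ 2 + Q x ^ 3
      - (c - 2 * κ) * Q x ^ 2 - 2 * A * Q x) (fun x => ?_) x⟩
    have := (((((d0 x).const_sub c).mul ((d1 x).pow 2)).add ((d0 x).pow 3)).sub
      (((d0 x).pow 2).const_mul (c - 2 * κ))).sub ((d0 x).const_mul (2 * A))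
    refine this.congr_deriv ?_
    simp only [Nat.cast_ofNat, Pi.pow_apply]
    linear_combination 2 * Q1 x * hA x
  have hcQ : Tendsto (fun x => c - Q x) atTop (𝓝 (c - 0)) := htop.const_sub c
  have hcne : ∀ᶠ x in atTop, c - Q x ≠ 0 := hcQ.eventually_ne (by simpa using hc0)
  -- Decay is assumed for `Q` alone. The second integral shows that `Q'²` converges to `B / c`,
  -- which must be `0`; the first then shows that `Q''` converges to `A / c`, which must be `0` as
  -- well.
  have hQ1sq : Tendsto (fun x => Q1 x ^ 2) atTop
      (𝓝 ((B - 0 ^ 3 + (c - 2 * κ) * 0 ^ 2 + 2 * A * 0) / (c - 0))) := by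
    refine Tendsto.congr' ?_ (((((htop.pow 3).const_sub B).add
      ((htop.pow 2).const_mul (c - 2 * κ))).add
      (htop.const_mul (2 * A))).div hcQ (by simpa using hc0))
    filter_upwards [hcne] with x hx
    rw [Pi.div_apply, div_eq_iff hx]
    linear_combination -(hB x)
  have hB0 : B = 0 := by
    have := eq_zero_of_tendsto_sq_deriv d0 htop hQ1sq
    simpa [hc0] using this
  have hQ1sq0 : Tendsto (fun x => Q1 x ^ 2) atTop (𝓝 0) := by
    simpa [hB0] using hQ1sq
  have hQ1 : Tendsto Q1 atTop (𝓝 0) := by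
    have := hQ1sq0.sqrt
    simp only [Real.sqrt_sq_eq_abs, Real.sqrt_zero] at this
    exact tendsto_zero_iff_abs_tendsto_zero _ |>.2 this
  have hQ2 : Tendsto Q2 atTop (𝓝 ((A + 0 / 2 - 3 / 2 * 0 ^ 2 + (c - 2 * κ) * 0) / (c - 0))) := by
    refine Tendsto.congr' ?_ (((((hQ1sq0.div_const 2).const_add A).sub
      ((htop.pow 2).const_mul (3 / 2))).add
      (htop.const_mul (c - 2 * κ))).div hcQ (by simpa using hc0))
    filter_upwards [hcne] with x hx
    rw [Pi.div_apply, div_eq_iff hx]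
    linear_combination -(hA x)
  have hA0 : A = 0 := by
    have := eq_zero_of_tendsto_sq_deriv d1 hQ1 (hQ2.pow 2)
    simpa [hc0] using this
  subst hA0 hB0
  have first : ∀ x, (c - Q x) * Q1 x ^ 2 = Q x ^ 2 * (c - 2 * κ - Q x) := fun x => by
    linear_combination hB x
  have second : ∀ x, (c - Q x) * Q2 x = Q1 x ^ 2 / 2 - 3 / 2 * Q x ^ 2 + (c - 2 * κ) * Q x :=
    fun x => by linear_combination hA x
  -- At `Q = c` the energy identity would read `0 = -2κc²`. By continuity and decay `Q` stays below
  -- `c`, so the factor `c - 2κ - Q` cannot be negative where `Q ≠ 0`.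
  have hne : ∀ x, Q x ≠ c := fun x hx => by
    have h1 := first x
    rw [hx] at h1
    have h2 : c ^ 2 * (2 * κ) = 0 := by linear_combination h1
    have : 0 < c ^ 2 * (2 * κ) := by have : 0 < c := by linarith
                                     positivity
    linarith
  have hlt : ∀ x, Q x < c := fun x => by
    by_contra hx
    push Not at hx
    have h1 : ∀ᶠ y in atTop, Q y < c := htop.eventually_lt_const (by linarith)
    obtain ⟨y, hy⟩ := h1.exists
    obtain ⟨z, hz⟩ := mem_range_of_exists_le_of_exists_ge hcont ⟨y, hy.le⟩ ⟨x, hx⟩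
    exact hne z hz
  have hle : ∀ x, Q x ≤ c - 2 * κ := fun x => by
    by_contra hx
    push Not at hx
    have h1 := first x
    have h2 : 0 ≤ (c - Q x) * Q1 x ^ 2 := mul_nonneg (by linarith [hlt x]) (sq_nonneg _)
    have h3 : 0 < Q x ^ 2 := by have : 0 < Q x := by linarith
                                positivity
    nlinarith
  -- A negative value would produce a negative global minimum, where `Q' = 0` but the right side of
  -- the energy identity is positive.
  have hnonneg : ∀ x, 0 ≤ Q x := fun x => by
    by_contra hx
    push Not at hx
    obtain ⟨m, hm⟩ := hcont.exists_forall_le' x (h.tendsto_zero.eventually_const_le hx)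
    have h1 : Q1 m = 0 :=
      (IsLocalMin.hasDerivAt_eq_zero (Eventually.of_forall hm) (d0 m))
    have h2 := first m
    have h3 := hm x
    have h4 : 0 < Q m ^ 2 := by have : Q m ≠ 0 := by linarith
                                positivity
    rw [h1] at h2
    nlinarith
  have hbound : ∀ x, |Q1 x| ≤ √((c - 2 * κ) / (2 * κ)) * |Q x| := fun x => by
    have h1 : Q1 x ^ 2 ≤ (c - 2 * κ) / (2 * κ) * Q x ^ 2 := by
      rw [div_mul_eq_mul_div, le_div_iff₀ (by positivity)]
      have h2 := first x
      nlinarith [mul_nonneg (sq_nonneg (Q1 x)) (sub_nonneg.2 (hle x)),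
        mul_nonneg (sq_nonneg (Q x)) (hnonneg x)]
    have h3 := Real.sqrt_le_sqrt h1
    rwa [Real.sqrt_sq_eq_abs, Real.sqrt_mul (by have : 0 < c - 2 * κ := by linarith
                                                positivity), Real.sqrt_sq_eq_abs] at h3
  have hpos : ∀ x, 0 < Q x := fun x => by
    refine lt_of_le_of_ne (hnonneg x) fun hx => h.ne_zero ?_
    ext y
    exact eq_zero_of_abs_deriv_le d0 hbound hx.symm y
  exact ⟨hκ, hc, d0, d1, d2, hcont3, h.tendsto_zero, hpos, hle, first, second,
    fun x => by linear_combination hode x⟩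

/-! ### Bounds on the profile and uniqueness of the crest. -/

namespace IsProfile

variable {κ c : ℝ} {Q Q1 Q2 Q3 : ℝ → ℝ} (h : IsProfile κ c Q Q1 Q2 Q3)
include h

theorem cont : Continuous Q := continuous_iff_continuousAt.2 fun x => (h.d0 x).continuousAt
theorem cont1 : Continuous Q1 := continuous_iff_continuousAt.2 fun x => (h.d1 x).continuousAt
theorem cont2 : Continuous Q2 := continuous_iff_continuousAt.2 fun x => (h.d2 x).continuousAt

theorem speed_sub_pos : 0 < c - 2 * κ := by linarith [h.hc]

theorem two_mul_le (x : ℝ) : 2 * κ ≤ c - Q x := by linarith [h.le x]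

theorem sub_pos (x : ℝ) : 0 < c - Q x := by linarith [h.two_mul_le x, h.hκ]

/-- The energy identity can be divided by `c - Q ≥ 2κ`. The same division in the other two
identities bounds `Q''` and `Q'''` by multiples of `Q`. -/
theorem exists_abs_Q1_le : ∃ K, 0 ≤ K ∧ ∀ x, |Q1 x| ≤ K * Q x := by
  refine ⟨√((c - 2 * κ) / (2 * κ)), Real.sqrt_nonneg _, fun x => ?_⟩
  have hκ := h.hκ
  have hs := h.speed_sub_pos
  have h1 : Q1 x ^ 2 ≤ (c - 2 * κ) / (2 * κ) * Q x ^ 2 := by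
    rw [div_mul_eq_mul_div, le_div_iff₀ (by positivity)]
    have h2 := h.first x
    nlinarith [mul_nonneg (sq_nonneg (Q1 x)) (sub_nonneg.2 (h.le x)),
      mul_nonneg (sq_nonneg (Q x)) (h.pos x).le]
  have h3 := Real.sqrt_le_sqrt h1
  rwa [Real.sqrt_sq_eq_abs, Real.sqrt_mul (by positivity), Real.sqrt_sq (h.pos x).le] at h3

theorem exists_abs_Q2_le : ∃ K, 0 ≤ K ∧ ∀ x, |Q2 x| ≤ K * Q x := by
  obtain ⟨K, hK, hle⟩ := h.exists_abs_Q1_le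
  have hκ := h.hκ
  have hs := h.speed_sub_pos
  refine ⟨(K ^ 2 / 2 * (c - 2 * κ) + 3 / 2 * (c - 2 * κ) + (c - 2 * κ)) / (2 * κ), by positivity,
    fun x => ?_⟩
  rw [div_mul_eq_mul_div, le_div_iff₀ (by positivity)]
  have h1 : |Q2 x| * (2 * κ) ≤ |(c - Q x) * Q2 x| := by
    rw [abs_mul, abs_of_pos (h.sub_pos x), mul_comm]
    exact mul_le_mul_of_nonneg_right (h.two_mul_le x) (abs_nonneg _)
  refine h1.trans ?_
  rw [h.second x]
  have hQ := h.pos x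
  have hQs := h.le x
  have h2 : Q1 x ^ 2 ≤ K ^ 2 * Q x ^ 2 := by
    rw [← sq_abs, ← mul_pow]; gcongr; exact hle x
  have h3 : Q x ^ 2 ≤ (c - 2 * κ) * Q x := by nlinarith
  have h4 : K ^ 2 * Q x ^ 2 ≤ K ^ 2 * ((c - 2 * κ) * Q x) := by gcongr
  have h5 := sq_nonneg (Q1 x)
  have h6 := sq_nonneg (Q x)
  have h7 : 0 ≤ (c - 2 * κ) * Q x := by positivity
  rw [abs_le]
  constructor <;> nlinarith

theorem exists_abs_Q3_le : ∃ K, 0 ≤ K ∧ ∀ x, |Q3 x| ≤ K * Q x := by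
  obtain ⟨K, hK, hle⟩ := h.exists_abs_Q1_le
  obtain ⟨K', hK', hle'⟩ := h.exists_abs_Q2_le
  have hκ := h.hκ
  have hs := h.speed_sub_pos
  refine ⟨(2 * K * (K' * (c - 2 * κ)) + 3 * (c - 2 * κ) * K + (c - 2 * κ) * K) / (2 * κ),
    by positivity, fun x => ?_⟩
  rw [div_mul_eq_mul_div, le_div_iff₀ (by positivity)]
  have h1 : |Q3 x| * (2 * κ) ≤ |(c - Q x) * Q3 x| := by
    rw [abs_mul, abs_of_pos (h.sub_pos x), mul_comm]
    exact mul_le_mul_of_nonneg_right (h.two_mul_le x) (abs_nonneg _)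
  refine h1.trans ?_
  rw [h.third x]
  have hQ := h.pos x
  have hQs := h.le x
  have e1 : |2 * Q1 x * Q2 x| ≤ 2 * (K * Q x) * (K' * (c - 2 * κ)) := by
    rw [abs_mul, abs_mul, abs_two]
    have : |Q2 x| ≤ K' * (c - 2 * κ) := (hle' x).trans (by gcongr)
    gcongr
    exact hle x
  have e2 : |3 * Q x * Q1 x| ≤ 3 * (c - 2 * κ) * (K * Q x) := by
    rw [abs_mul, abs_of_pos (by positivity)]
    gcongr
    exact hle x
  have e3 : |(c - 2 * κ) * Q1 x| ≤ (c - 2 * κ) * (K * Q x) := by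
    rw [abs_mul, abs_of_pos hs]
    gcongr
    exact hle x
  rw [abs_le] at *
  constructor <;> nlinarith

theorem Q1_eq_zero_iff (x : ℝ) : Q1 x = 0 ↔ Q x = c - 2 * κ := by
  have h1 := h.first x
  constructor
  · intro h0
    rw [h0] at h1
    have h2 : Q x ^ 2 * (c - 2 * κ - Q x) = 0 := by linarith
    have := (mul_eq_zero.1 h2).resolve_left (by have := h.pos x; positivity)
    linarith
  · intro h0
    rw [h0] at h1
    have h2 : κ * Q1 x ^ 2 = 0 := by linarith
    exact pow_eq_zero_iff two_ne_zero |>.1 ((mul_eq_zero.1 h2).resolve_left h.hκ.ne')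

/-- At the crest `Q = c - 2κ`, and the second-order identity gives `Q'' = -(c - 2κ)² / (4κ)`. -/
theorem Q2_neg_of_crit {x : ℝ} (hx : Q1 x = 0) : Q2 x < 0 := by
  have h1 := h.second x
  rw [hx, (h.Q1_eq_zero_iff x).1 hx] at h1
  have h2 : (2 * κ) * Q2 x = -((c - 2 * κ) ^ 2 / 2) := by linarith
  have h3 : 0 < (c - 2 * κ) ^ 2 := by have := h.speed_sub_pos; positivity
  by_contra hc
  push Not at hc
  have := mul_nonneg (by linarith [h.hκ] : 0 ≤ 2 * κ) hc
  linarith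

theorem exists_crit : ∃ x, Q1 x = 0 := by
  obtain ⟨m, hm⟩ := h.cont.exists_forall_ge' (0 : ℝ) (h.lim.eventually_le_const (h.pos 0))
  exact ⟨m, IsLocalMax.hasDerivAt_eq_zero (Eventually.of_forall hm) (h.d0 m)⟩

/-- Every critical point has the maximal height. The minimum of `Q` between two of them would have
that height too, so `Q` would be constant there, against `Q'' < 0`. -/
theorem crit_not_lt {x y : ℝ} (hx : Q1 x = 0) (hy : Q1 y = 0) : ¬ x < y := by
  intro hlt
  obtain ⟨z, hz, hmin⟩ := isCompact_Icc.exists_isMinOn (Set.nonempty_Icc.2 hlt.le)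
    h.cont.continuousOn
  have hzs : Q z = c - 2 * κ := by
    rcases hz.1.eq_or_lt with rfl | h1
    · exact (h.Q1_eq_zero_iff _).1 hx
    rcases hz.2.eq_or_lt with rfl | h2
    · exact (h.Q1_eq_zero_iff _).1 hy
    · exact (h.Q1_eq_zero_iff _).1
        (IsLocalMin.hasDerivAt_eq_zero (hmin.isLocalMin (Icc_mem_nhds h1 h2)) (h.d0 z))
  have hconst : ∀ w ∈ Set.Icc x y, Q1 w = 0 := fun w hw =>
    (h.Q1_eq_zero_iff w).2 (le_antisymm (h.le w) (hzs ▸ hmin hw))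
  set m := (x + y) / 2
  have hm : Set.Icc x y ∈ 𝓝 m := Icc_mem_nhds (by simp only [m]; linarith)
    (by simp only [m]; linarith)
  have h0 : HasDerivAt Q1 0 m := by
    refine (hasDerivAt_const m (0 : ℝ)).congr_of_eventuallyEq ?_
    filter_upwards [hm] with w hw using hconst w hw
  have h1 : Q2 m = 0 := (h.d1 m).unique h0
  exact (h.Q2_neg_of_crit (hconst m (mem_of_mem_nhds hm))).ne h1

theorem crit_unique {x y : ℝ} (hx : Q1 x = 0) (hy : Q1 y = 0) : x = y :=
  le_antisymm (not_lt.1 (h.crit_not_lt hy hx)) (not_lt.1 (h.crit_not_lt hx hy))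

/-- Away from the crest, `|Q'|` is comparable to `Q`. -/
theorem exists_le_abs_Q1 : ∃ η > 0, ∀ᶠ x in cocompact ℝ, η * Q x ≤ |Q1 x| := by
  have hs := h.speed_sub_pos
  have hc : 0 < c := by linarith [h.hκ, h.hc]
  refine ⟨√((c - 2 * κ) / 2 / c), by positivity, ?_⟩
  filter_upwards [h.lim.eventually_le_const (by positivity : 0 < (c - 2 * κ) / 2)] with x hx
  have h1 : (c - 2 * κ) / 2 / c * Q x ^ 2 ≤ Q1 x ^ 2 := by
    rw [div_mul_eq_mul_div, div_le_iff₀ hc]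
    have h2 := h.first x
    have h3 := mul_nonneg (sq_nonneg (Q1 x)) (h.pos x).le
    have h4 := mul_le_mul_of_nonneg_left hx (sq_nonneg (Q x))
    nlinarith
  have h3 := Real.sqrt_le_sqrt h1
  rwa [Real.sqrt_sq_eq_abs, Real.sqrt_mul (by positivity), Real.sqrt_sq (h.pos x).le] at h3

end IsProfile

/-! ### Integrability of the profile, and its negative energy. -/

theorem integrableOn_Ioi_of_mul_le_abs_deriv {f f' : ℝ → ℝ} {a η : ℝ} (hη : 0 < η)
    (hd : ∀ x, HasDerivAt f (f' x) x) (hf0 : ∀ x, 0 < f x)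
    (hle : ∀ x, a < x → η * f x ≤ |f' x|) (hlim : Tendsto f atTop (𝓝 0)) :
    IntegrableOn f (Set.Ioi a) := by
  have hcont : Continuous f := continuous_iff_continuousAt.2 fun x => (hd x).continuousAt
  have hint : IntegrableOn f' (Set.Ioi a) := by
    -- `f'` has no zero beyond `a`, so by Darboux it keeps its sign; since `f` has a limit, `f'` is
    -- integrable, and `f ≤ |f'| / η`.
    rcases hasDerivWithinAt_forall_lt_or_forall_gt_of_forall_ne (convex_Ioi a)
      (fun x _ => (hd x).hasDerivWithinAt) (m := 0) (fun x hx h0 => by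
        have := hle x hx
        rw [h0, abs_zero] at this
        exact absurd this (not_le.2 (mul_pos hη (hf0 x)))) with h1 | h1
    · exact integrableOn_Ioi_deriv_of_nonpos hcont.continuousWithinAt (fun x _ => hd x)
        (fun x hx => (h1 x hx).le) hlim
    · exact integrableOn_Ioi_deriv_of_nonneg hcont.continuousWithinAt (fun x _ => hd x)
        (fun x hx => (h1 x hx).le) hlim
  refine (hint.norm.const_mul η⁻¹).mono' hcont.aestronglyMeasurable ?_
  refine (ae_restrict_iff' measurableSet_Ioi).2 (Eventually.of_forall fun x hx => ?_)
  rw [Real.norm_eq_abs, abs_of_pos (hf0 x), Real.norm_eq_abs, ← div_eq_inv_mul, le_div_iff₀ hη,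
    mul_comm]
  exact hle x hx

namespace IsProfile

variable {κ c : ℝ} {Q Q1 Q2 Q3 : ℝ → ℝ} (h : IsProfile κ c Q Q1 Q2 Q3)
include h

theorem integrable : Integrable Q := by
  obtain ⟨η, hη, hle⟩ := h.exists_le_abs_Q1
  rw [cocompact_eq_atBot_atTop, eventually_sup] at hle
  have hlim := h.lim
  rw [cocompact_eq_atBot_atTop, tendsto_sup] at hlim
  obtain ⟨a, ha⟩ := eventually_atTop.1 hle.2
  obtain ⟨b, hb⟩ := eventually_atBot.1 hle.1
  have h1 : IntegrableOn Q (Set.Ioi a) :=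
    integrableOn_Ioi_of_mul_le_abs_deriv hη h.d0 h.pos (fun x hx => ha x hx.le) hlim.2
  have h2 : IntegrableOn (fun x => Q (-x)) (Set.Ioi (-b)) := by
    refine integrableOn_Ioi_of_mul_le_abs_deriv (f' := fun x => -Q1 (-x)) hη (fun x => ?_)
      (fun x => h.pos _) (fun x hx => ?_) (hlim.1.comp tendsto_neg_atTop_atBot)
    · have := (h.d0 (-x)).comp x (hasDerivAt_neg x)
      rw [mul_neg_one] at this
      exact this
    · rw [abs_neg]; exact hb _ (by linarith)
  have h3 : IntegrableOn Q (Set.Iio b) := by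
    have := (Measure.measurePreserving_neg (volume : Measure ℝ)).integrableOn_comp_preimage
      (Homeomorph.neg ℝ).measurableEmbedding (f := Q) (s := Set.Iio b)
    refine this.1 ?_
    have e : (Neg.neg ⁻¹' Set.Iio b : Set ℝ) = Set.Ioi (-b) := by ext x; simp
    rw [e]; exact h2
  have h4 : IntegrableOn Q (Set.Icc b a) := h.cont.continuousOn.integrableOn_Icc
  rw [← integrableOn_univ]
  refine ((h3.union h4).union h1).mono_set fun x _ => ?_
  simp only [Set.mem_union, Set.mem_Iio, Set.mem_Icc, Set.mem_Ioi]
  rcases lt_or_ge x b with hx | hx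
  · exact Or.inl (Or.inl hx)
  · rcases le_or_gt x a with hx' | hx'
    · exact Or.inl (Or.inr ⟨hx, hx'⟩)
    · exact Or.inr hx'

/-- Anything dominated by the profile is integrable. -/
theorem integrable_of_le {g : ℝ → ℝ} (hg : Continuous g) {K : ℝ} (hK : ∀ x, |g x| ≤ K * Q x) :
    Integrable g :=
  (h.integrable.const_mul K).mono' hg.aestronglyMeasurable (Eventually.of_forall hK)

theorem memLp_two_of_le {g : ℝ → ℝ} (hg : Continuous g) {K : ℝ} (hK : ∀ x, |g x| ≤ K * Q x) :
    MemLp (fun x => (g x : ℂ)) 2 (volume : Measure ℝ) := by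
  have h1 : MemLp g 2 (volume : Measure ℝ) := by
    rw [memLp_two_iff_integrable_sq hg.aestronglyMeasurable]
    refine h.integrable_of_le (hg.pow 2) (K := K ^ 2 * (c - 2 * κ)) fun x => ?_
    have h2 := pow_le_pow_left₀ (abs_nonneg _) (hK x) 2
    rw [abs_pow]
    refine h2.trans ?_
    have := mul_le_mul_of_nonneg_left (h.le x) (h.pos x).le
    nlinarith [mul_le_mul_of_nonneg_left this (sq_nonneg K)]
  exact h1.ofReal

/-- By the second-order identity the integrand equals `c (Q Q')' - 3/2 (Q Q'² + Q³)`; the exact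
derivative integrates to zero and the rest is negative. -/
theorem integral_form_neg : ∫ x, ((c - Q x) * Q1 x ^ 2
    + (Q2 x - 3 * Q x + c - 2 * κ) * Q x ^ 2) < 0 := by
  obtain ⟨K, hK, hle⟩ := h.exists_abs_Q1_le
  obtain ⟨K', hK', hle'⟩ := h.exists_abs_Q2_le
  have hs := h.speed_sub_pos
  have c0 := h.cont
  have c1 := h.cont1
  have c2 := h.cont2
  have hc : 0 < c := by linarith [h.hκ, h.hc]
  have hb1 : ∀ x, |Q1 x| ≤ K * (c - 2 * κ) := fun x =>
    (hle x).trans (mul_le_mul_of_nonneg_left (h.le x) hK)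
  have hb2 : ∀ x, |Q2 x| ≤ K' * (c - 2 * κ) := fun x =>
    (hle' x).trans (mul_le_mul_of_nonneg_left (h.le x) hK')
  have hQabs : ∀ x, |Q x| = Q x := fun x => abs_of_pos (h.pos x)
  have i1 : Integrable (fun x => Q x * Q1 x) :=
    h.integrable_of_le (by fun_prop) (K := K * (c - 2 * κ)) fun x => by
      rw [abs_mul, hQabs, mul_comm]; exact mul_le_mul_of_nonneg_right (hb1 x) (h.pos x).le
  have i2 : Integrable (fun x => Q1 x * Q1 x) :=
    h.integrable_of_le (by fun_prop) (K := K * (c - 2 * κ) * K) fun x => by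
      rw [abs_mul, mul_assoc]; exact mul_le_mul (hb1 x) (hle x) (abs_nonneg _) (by positivity)
  have i3 : Integrable (fun x => Q x * Q2 x) :=
    h.integrable_of_le (by fun_prop) (K := K' * (c - 2 * κ)) fun x => by
      rw [abs_mul, hQabs, mul_comm]; exact mul_le_mul_of_nonneg_right (hb2 x) (h.pos x).le
  have i4 : Integrable (fun x => Q x * (Q1 x * Q1 x)) := by
    refine (i2.const_mul (c - 2 * κ)).mono' (by fun_prop) (Eventually.of_forall fun x => ?_)
    rw [Real.norm_eq_abs, abs_mul, hQabs, abs_mul_self]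
    exact mul_le_mul_of_nonneg_right (h.le x) (mul_self_nonneg _)
  have i5 : Integrable (fun x => Q x ^ 3) :=
    h.integrable_of_le (by fun_prop) (K := (c - 2 * κ) ^ 2) fun x => by
      rw [abs_pow, hQabs, pow_succ]
      have := h.pos x
      have := h.le x
      gcongr
  have hG : ∀ x, HasDerivAt (fun x => c * (Q x * Q1 x)) (c * (Q1 x * Q1 x + Q x * Q2 x)) x :=
    fun x => ((h.d0 x).mul (h.d1 x)).const_mul c
  have hint0 : ∫ x, c * (Q1 x * Q1 x + Q x * Q2 x) = 0 :=
    integral_eq_zero_of_hasDerivAt_of_integrable hG ((i2.add i3).const_mul c) (i1.const_mul c)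
  have hpos : 0 < ∫ x, (Q x * (Q1 x * Q1 x) + Q x ^ 3) := by
    have hp : ∀ x, 0 < Q x * (Q1 x * Q1 x) + Q x ^ 3 := fun x => by
      have := h.pos x
      have := mul_self_nonneg (Q1 x)
      positivity
    rw [integral_pos_iff_support_of_nonneg (fun x => (hp x).le) (i4.add i5)]
    have : Function.support (fun x => Q x * (Q1 x * Q1 x) + Q x ^ 3) = Set.univ := by
      ext x; simp [(hp x).ne']
    rw [this]; simp
  have hsplit : ∀ x, (c - Q x) * Q1 x ^ 2 + (Q2 x - 3 * Q x + c - 2 * κ) * Q x ^ 2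
      = c * (Q1 x * Q1 x + Q x * Q2 x) - 3 / 2 * (Q x * (Q1 x * Q1 x) + Q x ^ 3) := fun x => by
    linear_combination -Q x * h.second x
  simp_rw [hsplit]
  have i6 : Integrable (fun x => c * (Q1 x * Q1 x + Q x * Q2 x)) := (i2.add i3).const_mul c
  have i7 : Integrable (fun x => 3 / 2 * (Q x * (Q1 x * Q1 x) + Q x ^ 3)) :=
    (i4.add i5).const_mul _
  rw [integral_sub i6 i7, hint0, integral_const_mul]
  linarith

end IsProfile

/-! ### Jacobi's argument at the crest. -/

namespace IsProfile

/-- The nonnegativity of the quadratic form of `M` on functions vanishing at the crest, by the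
Jacobi substitution `u = Q' v`. -/
theorem integral_form_nonneg_of_crest {κ c : ℝ} {Q Q1 Q2 Q3 : ℝ → ℝ}
    (h : IsProfile κ c Q Q1 Q2 Q3) {u u' : ℝ → ℝ} (hu : ∀ x, HasDerivAt u (u' x) x)
    (hu' : Continuous u') (hlim : Tendsto u (cocompact ℝ) (𝓝 0))
    {x₀ : ℝ} (hx₀ : Q1 x₀ = 0) (h0 : u x₀ = 0)
    (hint : Integrable (fun x => (c - Q x) * u' x ^ 2
      + (Q2 x - 3 * Q x + c - 2 * κ) * u x ^ 2)) :
    0 ≤ ∫ x, ((c - Q x) * u' x ^ 2 + (Q2 x - 3 * Q x + c - 2 * κ) * u x ^ 2) := by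
  have c0 := h.cont
  have c1 := h.cont1
  have c2 := h.cont2
  have cu : Continuous u := continuous_iff_continuousAt.2 fun x => (hu x).continuousAt
  set g : ℝ → ℝ := fun x => (c - Q x) * u' x ^ 2 + (Q2 x - 3 * Q x + c - 2 * κ) * u x ^ 2 with hg
  have cg : Continuous g := by fun_prop
  let F : ℝ → ℝ := fun x => (c - Q x) * Q2 x / Q1 x * u x ^ 2
  -- `F` is the boundary term of the substitution. Because `M Q' = 0` (the identity `third`), `G' =
  -- (c - Q) (u' - (Q''/Q') u)² ≥ 0` away from the crest.
  let G : ℝ → ℝ := fun x => (∫ t in x₀..x, g t) - F x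
  have hQ1ne : ∀ x, x ≠ x₀ → Q1 x ≠ 0 := fun x hx h1 => hx (h.crit_unique h1 hx₀)
  have hGd : ∀ x, x ≠ x₀ → HasDerivAt G ((c - Q x) * (u' x - Q2 x / Q1 x * u x) ^ 2) x := by
    intro x hx
    have hne := hQ1ne x hx
    have e1 : HasDerivAt (fun x => ∫ t in x₀..x, g t) (g x) x :=
      intervalIntegral.integral_hasDerivAt_right (cg.intervalIntegrable _ _)
        (cg.stronglyMeasurableAtFilter _ _) cg.continuousAt
    have e2 := ((((h.d0 x).const_sub c).mul (h.d2 x)).div (h.d1 x) hne).mul ((hu x).pow 2)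
    refine (e1.sub e2).congr_deriv ?_
    have e3 := h.third x
    simp only [hg, Pi.mul_apply, Pi.div_apply, Pi.pow_apply, Nat.cast_ofNat]
    field_simp
    linear_combination (-Q1 x * u x ^ 2) * e3
  -- `Q'` has a simple zero at `x₀` and `u` vanishes there, so `u / Q'` stays bounded and `u² / Q'`
  -- tends to `0`.
  have hG0 : Tendsto G (𝓝[≠] x₀) (𝓝 0) := by
    have e1 : Tendsto (fun x => ∫ t in x₀..x, g t) (𝓝[≠] x₀) (𝓝 0) := by
      have : ContinuousAt (fun x => ∫ t in x₀..x, g t) x₀ :=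
        (intervalIntegral.integral_hasDerivAt_right (cg.intervalIntegrable _ _)
          (cg.stronglyMeasurableAtFilter _ _) cg.continuousAt).continuousAt
      have h1 := this.tendsto
      rw [intervalIntegral.integral_same] at h1
      exact h1.mono_left nhdsWithin_le_nhds
    have e2 : Tendsto (slope u x₀) (𝓝[≠] x₀) (𝓝 (u' x₀)) := hasDerivAt_iff_tendsto_slope.1 (hu x₀)
    have e3 : Tendsto (slope Q1 x₀) (𝓝[≠] x₀) (𝓝 (Q2 x₀)) :=
      hasDerivAt_iff_tendsto_slope.1 (h.d1 x₀)
    have e4 : Tendsto (fun x => (c - Q x) * Q2 x * u x) (𝓝[≠] x₀) (𝓝 ((c - Q x₀) * Q2 x₀ * 0)) := by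
      have : Continuous fun x => (c - Q x) * Q2 x * u x := by fun_prop
      have h1 := this.tendsto x₀
      rw [h0] at h1
      exact h1.mono_left nhdsWithin_le_nhds
    have e5 := e4.mul (e2.div e3 (h.Q2_neg_of_crit hx₀).ne)
    rw [mul_zero, zero_mul] at e5
    have e6 : Tendsto F (𝓝[≠] x₀) (𝓝 0) := by
      refine e5.congr' ?_
      filter_upwards [self_mem_nhdsWithin] with x hx
      have hx' : x ≠ x₀ := hx
      have := hQ1ne x hx'
      have hxx : x - x₀ ≠ 0 := sub_ne_zero.2 hx'
      simp only [F, Pi.div_apply, slope_def_field, h0, hx₀, sub_zero]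
      field_simp
    simpa using e1.sub e6
  have hGpos : ∀ x, x₀ < x → 0 ≤ G x := by
    intro x hx
    have hmono : MonotoneOn G (Set.Ioi x₀) := by
      refine monotoneOn_of_deriv_nonneg (convex_Ioi x₀)
        (fun y hy => (hGd y (ne_of_gt hy)).continuousAt.continuousWithinAt) ?_ ?_
      · rw [interior_Ioi]
        exact fun y hy => (hGd y (ne_of_gt hy)).differentiableAt.differentiableWithinAt
      · rw [interior_Ioi]
        intro y hy
        rw [(hGd y (ne_of_gt hy)).deriv]
        exact mul_nonneg (h.sub_pos y).le (sq_nonneg _)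
    refine le_of_tendsto (hG0.mono_left (nhdsGT_le_nhdsNE x₀)) ?_
    filter_upwards [Ioo_mem_nhdsGT hx] with y hy
    exact hmono hy.1 hx hy.2.le
  have hGneg : ∀ x, x < x₀ → G x ≤ 0 := by
    intro x hx
    have hmono : MonotoneOn G (Set.Iio x₀) := by
      refine monotoneOn_of_deriv_nonneg (convex_Iio x₀)
        (fun y hy => (hGd y (ne_of_lt hy)).continuousAt.continuousWithinAt) ?_ ?_
      · rw [interior_Iio]
        exact fun y hy => (hGd y (ne_of_lt hy)).differentiableAt.differentiableWithinAt
      · rw [interior_Iio]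
        intro y hy
        rw [(hGd y (ne_of_lt hy)).deriv]
        exact mul_nonneg (h.sub_pos y).le (sq_nonneg _)
    refine ge_of_tendsto (hG0.mono_left (nhdsLT_le_nhdsNE x₀)) ?_
    filter_upwards [Ioo_mem_nhdsLT hx] with y hy
    exact hmono hx hy.2 hy.1.le
  -- Far from the crest both `|Q''|` and `|Q'|` compare with `Q`, so `Q''/Q'` is bounded, while `u`
  -- decays.
  have hF : Tendsto F (cocompact ℝ) (𝓝 0) := by
    obtain ⟨K, hK, hle⟩ := h.exists_abs_Q2_le
    obtain ⟨η, hη, hle'⟩ := h.exists_le_abs_Q1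
    have hb : Tendsto (fun x => c * (K / η) * u x ^ 2) (cocompact ℝ) (𝓝 0) := by
      simpa using (hlim.pow 2).const_mul (c * (K / η))
    refine squeeze_zero_norm' ?_ hb
    filter_upwards [hle'] with x hx
    have hQ := h.pos x
    have h1 : 0 < |Q1 x| := lt_of_lt_of_le (mul_pos hη hQ) hx
    have h2 : |Q2 x| / |Q1 x| ≤ K / η := by
      rw [div_le_div_iff₀ h1 hη]
      calc |Q2 x| * η ≤ K * Q x * η := by gcongr; exact hle x
        _ = K * (η * Q x) := by ring
        _ ≤ K * |Q1 x| := by gcongr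
    have h3 : c - Q x ≤ c := by linarith
    have h4 := h.sub_pos x
    simp only [F, norm_mul, norm_div, Real.norm_eq_abs, norm_pow, sq_abs]
    rw [abs_of_pos h4, mul_div_assoc]
    have hc0 : 0 ≤ c := by linarith
    gcongr
  rw [cocompact_eq_atBot_atTop, tendsto_sup] at hF
  have hR : 0 ≤ ∫ x in Set.Ioi x₀, g x := by
    have e1 := (intervalIntegral_tendsto_integral_Ioi x₀ hint.integrableOn tendsto_id).sub hF.2
    rw [sub_zero] at e1
    refine ge_of_tendsto e1 ?_
    filter_upwards [eventually_gt_atTop x₀] with x hx using hGpos x hx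
  have hL : 0 ≤ ∫ x in Set.Iic x₀, g x := by
    have e1 := (intervalIntegral_tendsto_integral_Iic x₀ hint.integrableOn tendsto_id).add hF.1
    rw [add_zero] at e1
    refine ge_of_tendsto e1 ?_
    filter_upwards [eventually_lt_atBot x₀] with x hx
    have := hGneg x hx
    simp only [G] at this
    rw [intervalIntegral.integral_symm] at this
    simp only [id]
    linarith
  rw [← intervalIntegral.integral_Iic_add_Ioi hint.integrableOn hint.integrableOn (b := x₀)]
  linarith

end IsProfile

/-! ### Multiplication forms, evaluation at a point, and interpolation. -/

theorem memLp_top_ofReal {a : ℝ → ℝ} (ha : Continuous a) {C : ℝ} (hC : ∀ x, |a x| ≤ C) :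
    MemLp (fun x => (a x : ℂ)) ∞ (volume : Measure ℝ) :=
  memLp_top_of_bound (by fun_prop) C (Eventually.of_forall fun x => by
    rw [Complex.norm_real]; exact hC x)

theorem re_inner_mulL {a : ℝ → ℝ} (ha : MemLp (fun x => (a x : ℂ)) ∞ (volume : Measure ℝ))
    (f : L2) : (⟪f, mulL _ ha f⟫_ℂ).re = ∫ x, a x * ‖f x‖ ^ 2 := by
  have h1 : ⟪f, mulL _ ha f⟫_ℂ = ∫ x, ((a x * ‖f x‖ ^ 2 : ℝ) : ℂ) := by
    rw [L2_inner]
    refine integral_congr_ae ?_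
    filter_upwards [mulL_ae _ ha f] with x hx
    rw [hx, mul_left_comm, Complex.conj_mul']
    push_cast; rfl
  rw [h1, integral_complex_ofReal, Complex.ofReal_re]

theorem integrable_mul_norm_sq {a : ℝ → ℝ}
    (ha : MemLp (fun x => (a x : ℂ)) ∞ (volume : Measure ℝ)) (f : L2) :
    Integrable (fun x => a x * ‖f x‖ ^ 2) := by
  have h1 : Integrable (fun x => ‖f x‖ ^ 2) := (Lp.memLp f).integrable_norm_pow two_ne_zero
  have h2 : MemLp a ∞ (volume : Measure ℝ) := by simpa using ha.re
  exact h1.mul_of_top_right h2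

/-- The Riesz representative of the functional `w ↦ (opD w)(x₀)`. -/
theorem exists_eval_functional (x₀ : ℝ) : ∃ k : L2, ∀ φ : 𝓢(ℝ, ℂ),
    ⟪k, φ.toLp 2 volume⟫_ℂ = SchwartzMap.fourierMultiplierCLM ℂ symD φ x₀ := by
  -- Fourier inversion at `x₀` writes the evaluation as a pairing with this function; it is square
  -- integrable since `|symD ξ|² ≤ 4π² / (1 + ξ²)`.
  let k' : ℝ → ℂ := fun ξ => starRingEnd ℂ ((Real.fourierChar (inner ℝ ξ x₀) : ℂ) * symD ξ)
  have hcont : Continuous k' := by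
    have := symD_temperate.1.continuous
    have h2 : Continuous fun ξ : ℝ => (Real.fourierChar (inner ℝ ξ x₀) : ℂ) := by fun_prop
    exact Complex.continuous_conj.comp (h2.mul this)
  have hk' : MemLp k' 2 (volume : Measure ℝ) := by
    rw [memLp_two_iff_integrable_sq_norm hcont.aestronglyMeasurable]
    refine (integrable_inv_one_add_sq.const_mul (4 * Real.pi ^ 2)).mono'
      (hcont.norm.pow 2).aestronglyMeasurable (Eventually.of_forall fun x => ?_)
    rw [norm_pow, norm_norm, RCLike.norm_conj, norm_mul, Circle.norm_coe, one_mul]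
    exact norm_symD_sq_le x
  refine ⟨𝓕⁻ (hk'.toLp k'), fun φ => ?_⟩
  rw [← Lp.inner_fourier_eq, FourierTransform.fourier_fourierInv_eq, SchwartzMap.toLp_fourier_eq,
    SchwartzMap.fourierMultiplierCLM_apply, SchwartzMap.fourierInv_coe, Real.fourierInv_eq,
    L2_inner]
  refine integral_congr_ae ?_
  filter_upwards [hk'.coeFn_toLp, (𝓕 φ).coeFn_toLp 2 volume] with x h1 h2
  rw [h1, h2, Complex.conj_conj, SchwartzMap.smulLeftCLM_apply_apply symD_temperate, smul_eq_mul,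
    Circle.smul_def, smul_eq_mul, mul_assoc]

theorem opD_toLp (φ : 𝓢(ℝ, ℂ)) :
    opD (φ.toLp 2 volume) = (SchwartzMap.fourierMultiplierCLM ℂ symD φ).toLp 2 volume := by
  apply toDistr_injective
  rw [opD, toDistr_fmul _ _ symD_temperate]
  change TemperedDistribution.fourierMultiplierCLM ℂ symD
    (Lp.toTemperedDistribution (φ.toLp 2 volume)) = Lp.toTemperedDistribution _
  rw [Lp.toTemperedDistribution_toLp_eq, Lp.toTemperedDistribution_toLp_eq,
    TemperedDistribution.fourierMultiplierCLM_toTemperedDistributionCLM_eq symD_temperate]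

theorem toLp_derivCLM_mem_dX (φ : 𝓢(ℝ, ℂ)) :
    (φ.toLp 2 volume, (SchwartzMap.derivCLM ℂ ℂ φ).toLp 2 volume) ∈ dX.graph := by
  refine toLp_mem_dX (fun x => ?_) _ _
  rw [SchwartzMap.derivCLM_apply]; exact φ.differentiableAt.hasDerivAt

theorem opDD_toLp (φ : 𝓢(ℝ, ℂ)) : opDD (φ.toLp 2 volume) =
    (SchwartzMap.derivCLM ℂ ℂ (SchwartzMap.fourierMultiplierCLM ℂ symD φ)).toLp 2 volume :=
  dX_unique (opD_toLp φ ▸ opD_opDD_mem (φ.toLp 2 volume)) (toLp_derivCLM_mem_dX _)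

/-- If some `η` in `D` is off the hyperplane, projecting along `η` is continuous, preserves `D` and
fixes the hyperplane; otherwise `D` lies inside it. -/
theorem mem_closure_inter_hyperplane {H : Type*} [NormedAddCommGroup H] [InnerProductSpace ℂ H]
    (D : Submodule ℂ H) (hD : Dense (D : Set H)) (k : H) {w : H} (hw : ⟪k, w⟫_ℂ = 0) :
    w ∈ closure {v | v ∈ D ∧ ⟪k, v⟫_ℂ = 0} := by
  by_cases hη : ∃ η ∈ D, ⟪k, η⟫_ℂ ≠ 0
  · obtain ⟨η, hηD, hη⟩ := hη
    let T : H → H := fun v => v - (⟪k, v⟫_ℂ / ⟪k, η⟫_ℂ) • η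
    have hT : Continuous T := by fun_prop
    have h1 : T w ∈ closure (T '' D) := mem_closure_image hT.continuousAt (hD w)
    have h2 : T w = w := by simp [T, hw]
    rw [h2] at h1
    refine closure_mono ?_ h1
    rintro _ ⟨v, hv, rfl⟩
    change T v ∈ D ∧ ⟪k, T v⟫_ℂ = 0
    refine ⟨D.sub_mem hv (D.smul_mem _ hηD), ?_⟩
    simp only [T]
    rw [inner_sub_right, inner_smul_right, div_mul_cancel₀ _ hη, sub_self]
  · push Not at hη
    exact closure_mono (t := {v | v ∈ D ∧ ⟪k, v⟫_ℂ = 0})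
      (fun v hv => And.intro hv (hη v hv)) (hD w)

theorem L2_norm_sq (f : L2) : ‖f‖ ^ 2 = ∫ x, ‖f x‖ ^ 2 := by
  have h1 : ⟪f, f⟫_ℂ = ∫ x, ((‖f x‖ ^ 2 : ℝ) : ℂ) := by
    rw [L2_inner]
    refine integral_congr_ae (Eventually.of_forall fun x => ?_)
    dsimp only
    rw [Complex.conj_mul']
    push_cast; rfl
  rw [inner_self_eq_norm_sq_to_K, integral_complex_ofReal] at h1
  rw [← Complex.ofReal_inj, ← h1]
  push_cast; rfl

theorem mul_norm_sq_le_re_inner_mulL {a : ℝ → ℝ} {m : ℝ} (hm : ∀ x, m ≤ a x)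
    (ha : MemLp (fun x => (a x : ℂ)) ∞ (volume : Measure ℝ)) (f : L2) :
    m * ‖f‖ ^ 2 ≤ (⟪f, mulL _ ha f⟫_ℂ).re := by
  rw [re_inner_mulL, L2_norm_sq, ← integral_const_mul]
  refine integral_mono ?_ (integrable_mul_norm_sq ha f) fun x => ?_
  · exact ((Lp.memLp f).integrable_norm_pow two_ne_zero).const_mul m
  · exact mul_le_mul_of_nonneg_right (hm x) (sq_nonneg _)

theorem inner_opDD (f g : L2) : ⟪f, opDD g⟫_ℂ = ⟪opDD f, g⟫_ℂ := by
  rw [opDD_apply, opDD_apply, inner_smul_left, inner_smul_right, inner_sub_left, inner_sub_right,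
    inner_opJ, Complex.conj_ofReal]

/-- Integration by parts for `f = J w`: `‖f'‖² = -⟪f'', f⟫`. -/
theorem norm_opD_sq_le (w : L2) : ‖opD w‖ ^ 2 ≤ ‖opDD w‖ * ‖opJ w‖ := by
  have h1 : ⟪opD w, opD w⟫_ℂ = -⟪opDD w, opJ w⟫_ℂ := by
    rw [inner_opD, opD_eq_of_mem (opD_opDD_mem w), inner_opJ]
  have h2 := congrArg norm h1
  rw [norm_neg, inner_self_eq_norm_sq_to_K] at h2
  have h3 := norm_inner_le_norm (𝕜 := ℂ) (opDD w) (opJ w)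
  rw [← h2] at h3
  simpa using h3

theorem norm_le_opJ_add_opDD (w : L2) : ‖w‖ ≤ ‖opJ w‖ + ‖opDD w‖ := by
  have hpi : 1 < 4 * Real.pi ^ 2 := by nlinarith [Real.pi_gt_three]
  have h1 : ‖opDD w‖ = 4 * Real.pi ^ 2 * ‖opJ w - w‖ := by
    rw [opDD_apply, norm_smul, Complex.norm_real, Real.norm_eq_abs, abs_of_pos (by linarith)]
  have h2 : ‖w‖ ≤ ‖opJ w‖ + ‖opJ w - w‖ := by
    have := norm_sub_le (opJ w) (opJ w - w)
    simpa using this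
  nlinarith [norm_nonneg (opJ w - w)]

/-! ### The form of `L`: Gårding's inequality, the hyperplane, the negative direction. -/

namespace IsProfile

variable {κ c : ℝ} {Q Q1 Q2 Q3 : ℝ → ℝ} (h : IsProfile κ c Q Q1 Q2 Q3)
include h

theorem memLp_main : MemLp (fun x => ((c - Q x : ℝ) : ℂ)) ∞ (volume : Measure ℝ) :=
  memLp_top_ofReal (by have := h.cont; fun_prop) (C := c) fun x => by
    rw [abs_of_pos (h.sub_pos x)]; linarith [h.pos x]

theorem exists_abs_pot_le : ∃ C, ∀ x, |Q2 x - 3 * Q x + c - 2 * κ| ≤ C := by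
  obtain ⟨K, hK, hle⟩ := h.exists_abs_Q2_le
  refine ⟨K * (c - 2 * κ) + 3 * (c - 2 * κ) + (c - 2 * κ), fun x => ?_⟩
  have h1 := (hle x).trans (mul_le_mul_of_nonneg_left (h.le x) hK)
  have h2 := h.pos x
  have h3 := h.le x
  rw [abs_le] at *
  constructor <;> linarith

theorem memLp_pot :
    MemLp (fun x => ((Q2 x - 3 * Q x + c - 2 * κ : ℝ) : ℂ)) ∞ (volume : Measure ℝ) := by
  obtain ⟨C, hC⟩ := h.exists_abs_pot_le
  exact memLp_top_ofReal (by have := h.cont; have := h.cont2; fun_prop) hC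

/-- The quadratic form of `M` on pairs `(u, u')`. -/
def form (p : L2 × L2) : ℝ :=
  (⟪p.2, mulL _ h.memLp_main p.2⟫_ℂ).re + (⟪p.1, mulL _ h.memLp_pot p.1⟫_ℂ).re

theorem continuous_form : Continuous h.form := by
  unfold form
  fun_prop

theorem form_eq_integral (p : L2 × L2) : h.form p =
    ∫ x, ((c - Q x) * ‖p.2 x‖ ^ 2 + (Q2 x - 3 * Q x + c - 2 * κ) * ‖p.1 x‖ ^ 2) := by
  rw [integral_add (integrable_mul_norm_sq h.memLp_main p.2)
    (integrable_mul_norm_sq h.memLp_pot p.1), form, re_inner_mulL, re_inner_mulL]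

/-- The bounded operator representing the quadratic form of `L` on `H²(ℝ)`, identified with
`L²(ℝ)` by the Bessel potential. -/
def opA : L2 →L[ℂ] L2 :=
  opDD ∘L mulL _ h.memLp_main ∘L opDD - opD ∘L mulL _ h.memLp_pot ∘L opD

theorem opA_apply (w : L2) : h.opA w =
    opDD (mulL _ h.memLp_main (opDD w)) - opD (mulL _ h.memLp_pot (opD w)) := rfl

theorem inner_opA_eq (u w : L2) : ⟪u, h.opA w⟫_ℂ =
    ⟪opDD u, mulL _ h.memLp_main (opDD w)⟫_ℂ + ⟪opD u, mulL _ h.memLp_pot (opD w)⟫_ℂ := by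
  rw [opA_apply, inner_sub_right, inner_opDD, inner_opD, sub_neg_eq_add]

theorem inner_opA (u w : L2) : ⟪u, h.opA w⟫_ℂ = ⟪h.opA u, w⟫_ℂ := by
  rw [← inner_conj_symm (h.opA u), inner_opA_eq, inner_opA_eq, map_add, inner_conj_symm,
    inner_conj_symm, inner_mulL_left _ _ fun x => Complex.conj_ofReal _,
    inner_mulL_left _ _ fun x => Complex.conj_ofReal _]

theorem re_inner_opA (w : L2) : (⟪w, h.opA w⟫_ℂ).re = h.form (opD w, opDD w) := by
  rw [inner_opA_eq, Complex.add_re, form]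

/-- For `f = J w`, the leading term controls `2κ ‖f''‖²`. The potential costs at most `K ‖f'‖² ≤ K
‖f''‖ ‖f‖`, absorbed with weight `κ`; the remaining `κ ‖f''‖²` and `‖f‖²` control `‖w‖²`. -/
theorem garding : ∃ δ > 0, ∃ C, ∀ w, δ * ‖w‖ ^ 2 ≤ (⟪w, h.opA w⟫_ℂ).re + C * ‖opJ w‖ ^ 2 := by
  obtain ⟨K, hK⟩ := h.exists_abs_pot_le
  have hκ := h.hκ
  refine ⟨κ / 2, by positivity, K ^ 2 / (4 * κ) + κ, fun w => ?_⟩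
  rw [re_inner_opA, form]
  have h1 := mul_norm_sq_le_re_inner_mulL h.two_mul_le h.memLp_main (opDD w)
  have h2 := mul_norm_sq_le_re_inner_mulL (fun x => (abs_le.1 (hK x)).1) h.memLp_pot (opD w)
  have h3 := norm_opD_sq_le w
  have h4 := norm_le_opJ_add_opDD w
  have hK0 : 0 ≤ K := (abs_nonneg _).trans (hK 0)
  simp only
  set X := ‖opJ w‖
  set Y := ‖opDD w‖
  have h5 : ‖w‖ ^ 2 ≤ 2 * X ^ 2 + 2 * Y ^ 2 := by
    nlinarith [pow_le_pow_left₀ (norm_nonneg w) h4 2, sq_nonneg (X - Y)]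
  have h6 : K * (Y * X) ≤ κ * Y ^ 2 + K ^ 2 / (4 * κ) * X ^ 2 := by
    have : κ * Y ^ 2 + K ^ 2 / (4 * κ) * X ^ 2 - K * (Y * X) =
        (2 * κ * Y - K * X) ^ 2 / (4 * κ) := by
      field_simp; ring
    have : 0 ≤ (2 * κ * Y - K * X) ^ 2 / (4 * κ) := by positivity
    linarith
  have h7 : K * ‖opD w‖ ^ 2 ≤ K * (Y * X) := by gcongr
  have h8 : κ / 2 * ‖w‖ ^ 2 ≤ κ / 2 * (2 * X ^ 2 + 2 * Y ^ 2) := by gcongr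
  nlinarith

theorem form_toLp_nonneg {x₀ : ℝ} (hx₀ : Q1 x₀ = 0) (φ : 𝓢(ℝ, ℂ)) (h0 : φ x₀ = 0) :
    0 ≤ h.form (φ.toLp 2 volume, (SchwartzMap.derivCLM ℂ ℂ φ).toLp 2 volume) := by
  set φ' := SchwartzMap.derivCLM ℂ ℂ φ with hφ'
  have hd : ∀ x, HasDerivAt φ (φ' x) x := fun x => by
    rw [hφ', SchwartzMap.derivCLM_apply]; exact φ.differentiableAt.hasDerivAt
  have hp : MemLp (fun x => c - Q x) ∞ (volume : Measure ℝ) := by simpa using h.memLp_main.re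
  have hq : MemLp (fun x => Q2 x - 3 * Q x + c - 2 * κ) ∞ (volume : Measure ℝ) := by
    simpa using h.memLp_pot.re
  -- The coefficients are real, so the form splits over real and imaginary parts, each vanishing at
  -- the crest.
  have key : ∀ L : ℂ →L[ℝ] ℝ,
      Integrable (fun x => (c - Q x) * L (φ' x) ^ 2 + (Q2 x - 3 * Q x + c - 2 * κ) * L (φ x) ^ 2) ∧
      0 ≤ ∫ x, ((c - Q x) * L (φ' x) ^ 2 + (Q2 x - 3 * Q x + c - 2 * κ) * L (φ x) ^ 2) := by
    intro L
    have hint : ∀ ψ : 𝓢(ℝ, ℂ), Integrable (fun x => L (ψ x) ^ 2) := fun ψ => by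
      have h1 : MemLp (fun x => L (ψ x)) 2 (volume : Measure ℝ) := L.comp_memLp' (ψ.memLp 2 volume)
      exact (memLp_two_iff_integrable_sq h1.1).1 h1
    have hi := ((hint φ').mul_of_top_right hp).add ((hint φ).mul_of_top_right hq)
    refine ⟨hi, h.integral_form_nonneg_of_crest (u := fun x => L (φ x)) (u' := fun x => L (φ' x))
      (fun x => L.hasFDerivAt.comp_hasDerivAt x (hd x)) (by fun_prop) ?_ hx₀
      (by simp [h0]) hi⟩
    have h1 : Tendsto φ (cocompact ℝ) (𝓝 0) := zero_at_infty φ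
    have h2 := (L.continuous.tendsto 0).comp h1
    rwa [map_zero] at h2
  rw [form_eq_integral]
  have e : ∫ x, ((c - Q x) * ‖(φ'.toLp 2 volume) x‖ ^ 2
      + (Q2 x - 3 * Q x + c - 2 * κ) * ‖(φ.toLp 2 volume) x‖ ^ 2)
      = (∫ x, ((c - Q x) * Complex.reCLM (φ' x) ^ 2
          + (Q2 x - 3 * Q x + c - 2 * κ) * Complex.reCLM (φ x) ^ 2))
        + ∫ x, ((c - Q x) * Complex.imCLM (φ' x) ^ 2
          + (Q2 x - 3 * Q x + c - 2 * κ) * Complex.imCLM (φ x) ^ 2) := by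
    rw [← integral_add (key Complex.reCLM).1 (key Complex.imCLM).1]
    refine integral_congr_ae ?_
    filter_upwards [φ.coeFn_toLp 2 volume, φ'.coeFn_toLp 2 volume] with x h1 h2
    rw [h1, h2, Complex.sq_norm, Complex.sq_norm, Complex.normSq_apply, Complex.normSq_apply]
    simp only [Complex.reCLM_apply, Complex.imCLM_apply]
    ring
  rw [e]
  exact add_nonneg (key _).2 (key _).2

/-- `k` represents `w ↦ (∂J w)(x₀)` at the crest. For Schwartz `w` Jacobi's argument applies to `u =
∂J w`; density within the hyperplane does the rest. -/
theorem exists_hyperplane : ∃ k : L2, ∀ w, ⟪k, w⟫_ℂ = 0 → 0 ≤ (⟪w, h.opA w⟫_ℂ).re := by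
  obtain ⟨x₀, hx₀⟩ := h.exists_crit
  obtain ⟨k, hk⟩ := exists_eval_functional x₀
  refine ⟨k, fun w hw => ?_⟩
  let D : Submodule ℂ L2 := (SchwartzMap.toLpCLM ℂ ℂ 2 (volume : Measure ℝ)).range
  have hD : Dense (D : Set L2) := SchwartzMap.denseRange_toLpCLM ENNReal.ofNat_ne_top
  have hcl : IsClosed {w : L2 | 0 ≤ (⟪w, h.opA w⟫_ℂ).re} :=
    isClosed_le continuous_const (by fun_prop)
  refine closure_minimal ?_ hcl (mem_closure_inter_hyperplane D hD k hw)
  rintro _ ⟨⟨φ, rfl⟩, hφ⟩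
  change ⟪k, φ.toLp 2 volume⟫_ℂ = 0 at hφ
  change 0 ≤ (⟪φ.toLp 2 volume, h.opA (φ.toLp 2 volume)⟫_ℂ).re
  rw [re_inner_opA, opD_toLp, opDD_toLp]
  rw [hk] at hφ
  exact h.form_toLp_nonneg hx₀ _ hφ

/-- A positive function has no square integrable primitive, so `Q` is not of the form `∂J w`. The
pair `(Q, Q')` is instead approximated by pairs `(∂J w, ∂²J w)`, and negativity is an open
condition. -/
theorem exists_neg : ∃ w, (⟪w, h.opA w⟫_ℂ).re < 0 := by
  obtain ⟨K, -, hK⟩ := h.exists_abs_Q1_le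
  have m0 := h.memLp_two_of_le h.cont (K := 1) fun x => by rw [abs_of_pos (h.pos x), one_mul]
  have m1 := h.memLp_two_of_le h.cont1 hK
  have hmem : (m0.toLp _, m1.toLp _) ∈ dX.graph := toLp_mem_dX (fun x => (h.d0 x).ofReal_comp) _ _
  have hneg : h.form (m0.toLp _, m1.toLp _) < 0 := by
    rw [form_eq_integral]
    refine lt_of_eq_of_lt (integral_congr_ae ?_) h.integral_form_neg
    filter_upwards [m0.coeFn_toLp, m1.coeFn_toLp] with x h1 h2
    rw [h1, h2, Complex.norm_real, Complex.norm_real, Real.norm_eq_abs, Real.norm_eq_abs, sq_abs,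
      sq_abs]
  have hopen : IsOpen {p | h.form p < 0} := isOpen_lt h.continuous_form continuous_const
  obtain ⟨_, hp, ⟨w, rfl⟩⟩ := mem_closure_iff.1 (mem_closure_opD_opDD hmem) _ hopen hneg
  exact ⟨w, by rw [re_inner_opA]; exact hp⟩

end IsProfile

/-! ### Graphs of restrictions, sums and negatives, and products in `H²`. -/

section Graphs

variable {E : Type*} [NormedAddCommGroup E] [NormedSpace ℂ E]

theorem mem_domRestrict_graph (f : E →ₗ.[ℂ] E) (S : Submodule ℂ E) (x y : E) :
    (x, y) ∈ (f.domRestrict S).graph ↔ x ∈ S ∧ (x, y) ∈ f.graph := by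
  simp only [LinearPMap.mem_graph_iff]
  constructor
  · rintro ⟨⟨x, hxS, hxf⟩, rfl, rfl⟩
    exact ⟨hxS, ⟨x, hxf⟩, rfl, rfl⟩
  · rintro ⟨hxS, ⟨x, hxf⟩, rfl, rfl⟩
    exact ⟨⟨x, hxS, hxf⟩, rfl, rfl⟩

theorem mem_add_graph (f g : E →ₗ.[ℂ] E) (x y : E) :
    (x, y) ∈ (f + g).graph ↔ ∃ a b, (x, a) ∈ f.graph ∧ (x, b) ∈ g.graph ∧ y = a + b := by
  simp only [LinearPMap.mem_graph_iff]
  constructor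
  · rintro ⟨⟨x, hxf, hxg⟩, rfl, rfl⟩
    exact ⟨f ⟨x, hxf⟩, g ⟨x, hxg⟩, ⟨_, rfl, rfl⟩, ⟨_, rfl, rfl⟩, rfl⟩
  · rintro ⟨_, _, ⟨⟨x, hxf⟩, rfl, rfl⟩, ⟨⟨x', hxg⟩, rfl, rfl⟩, rfl⟩
    exact ⟨⟨x', hxf, hxg⟩, rfl, rfl⟩

theorem mem_neg_graph (f : E →ₗ.[ℂ] E) (x y : E) :
    (x, y) ∈ (-f).graph ↔ (x, -y) ∈ f.graph := by
  simp only [LinearPMap.mem_graph_iff]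
  constructor
  · rintro ⟨x, rfl, rfl⟩
    exact ⟨x, rfl, by rw [LinearPMap.neg_apply, neg_neg]⟩
  · rintro ⟨x, rfl, hx⟩
    exact ⟨x, rfl, by rw [LinearPMap.neg_apply, hx, neg_neg]⟩

end Graphs

theorem opDD_opJ (w : L2) : opDD (opJ w) = opJ (opDD w) := by
  rw [opDD_apply, opDD_apply, map_smul, map_sub]

theorem mulL_mem_sobolevH_two {a a' a'' : ℝ → ℂ} (hd : ∀ x, HasDerivAt a (a' x) x)
    (hd' : ∀ x, HasDerivAt a' (a'' x) x) (ha : MemLp a ∞ (volume : Measure ℝ))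
    (ha' : MemLp a' ∞ (volume : Measure ℝ)) (ha'' : MemLp a'' ∞ (volume : Measure ℝ)) {f : L2}
    (hf : f ∈ sobolevH 2) : mulL a ha f ∈ sobolevH 2 := by
  obtain ⟨g, k, hg, hk⟩ := (mem_sobolevH_two_iff_dX f).1 hf
  exact (mem_sobolevH_two_iff_dX _).2 ⟨_, _, mulL_mem_dX hd ha ha' hg,
    dX.graph.add_mem (mulL_mem_dX hd' ha' ha'' hg) (mulL_mem_dX hd ha ha' hk)⟩

/-! ### Regularity of the coefficients `c - Q`, `(c - Q)⁻¹` and `q`. -/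

namespace IsProfile

variable {κ c : ℝ} {Q Q1 Q2 Q3 : ℝ → ℝ} (h : IsProfile κ c Q Q1 Q2 Q3)
include h

theorem exists_bounds : ∃ K, 0 ≤ K ∧ ∀ x, |Q x| ≤ K ∧ |Q1 x| ≤ K ∧ |Q2 x| ≤ K ∧ |Q3 x| ≤ K := by
  obtain ⟨K1, hK1, h1⟩ := h.exists_abs_Q1_le
  obtain ⟨K2, hK2, h2⟩ := h.exists_abs_Q2_le
  obtain ⟨K3, hK3, h3⟩ := h.exists_abs_Q3_le
  have hs := h.speed_sub_pos
  refine ⟨(1 + K1 + K2 + K3) * (c - 2 * κ), by positivity, fun x => ?_⟩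
  have hQ := h.pos x
  have hle : (1 + K1 + K2 + K3) * Q x ≤ (1 + K1 + K2 + K3) * (c - 2 * κ) := by
    have := h.le x; gcongr
  refine ⟨?_, (h1 x).trans ?_, (h2 x).trans ?_, (h3 x).trans ?_⟩
  · rw [abs_of_pos hQ]; nlinarith
  · nlinarith
  · nlinarith
  · nlinarith

theorem mulL_main_mem {f : L2} (hf : f ∈ sobolevH 2) : mulL _ h.memLp_main f ∈ sobolevH 2 := by
  obtain ⟨K, hK, hb⟩ := h.exists_bounds
  exact mulL_mem_sobolevH_two
    (fun x => ((h.d0 x).const_sub c).ofReal_comp) (fun x => (h.d1 x).neg.ofReal_comp) _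
    (memLp_top_ofReal (a := fun x => -Q1 x) h.cont1.neg (C := K) fun x => by
      rw [abs_neg]; exact (hb x).2.1)
    (memLp_top_ofReal (a := fun x => -Q2 x) h.cont2.neg (C := K) fun x => by
      rw [abs_neg]; exact (hb x).2.2.1) hf

/-- Only one derivative is available: `q` contains `Q''` and `Q` is `C³`. One is enough, since `q`
stands under a single outer derivative in `L`. -/
theorem mulL_pot_mem_dX {f g : L2} (hf : (f, g) ∈ dX.graph) :
    ∃ v, (mulL _ h.memLp_pot f, v) ∈ dX.graph := by
  obtain ⟨K, hK, hb⟩ := h.exists_bounds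
  have hd : ∀ x, HasDerivAt (fun x => Q2 x - 3 * Q x + c - 2 * κ) (Q3 x - 3 * Q1 x) x := fun x =>
    ((((h.d2 x).sub ((h.d0 x).const_mul 3)).add_const c).sub_const (2 * κ))
  refine ⟨_, mulL_mem_dX (fun x => (hd x).ofReal_comp) h.memLp_pot
    (memLp_top_ofReal (a := fun x => Q3 x - 3 * Q1 x) ?_ (C := 4 * K) fun x => ?_) hf⟩
  · have := h.cont3; have := h.cont1; fun_prop
  · obtain ⟨-, h1, -, h3⟩ := hb x
    rw [abs_le] at *
    constructor <;> linarith

theorem cont_inv : Continuous fun x => (c - Q x)⁻¹ :=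
  (continuous_const.sub h.cont).inv₀ fun x => (h.sub_pos x).ne'

theorem abs_inv_le (x : ℝ) : |(c - Q x)⁻¹| ≤ (2 * κ)⁻¹ := by
  rw [abs_of_pos (inv_pos.2 (h.sub_pos x))]
  exact inv_anti₀ (by linarith [h.hκ]) (h.two_mul_le x)

theorem memLp_inv : MemLp (fun x => (((c - Q x)⁻¹ : ℝ) : ℂ)) ∞ (volume : Measure ℝ) :=
  memLp_top_ofReal h.cont_inv h.abs_inv_le

theorem hasDerivAt_inv (x : ℝ) :
    HasDerivAt (fun x => (c - Q x)⁻¹) (Q1 x * ((c - Q x)⁻¹ * (c - Q x)⁻¹)) x := by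
  refine (((h.d0 x).const_sub c).inv (h.sub_pos x).ne').congr_deriv ?_
  have := (h.sub_pos x).ne'
  field_simp

theorem memLp_inv_deriv : MemLp (fun x => ((Q1 x * ((c - Q x)⁻¹ * (c - Q x)⁻¹) : ℝ) : ℂ)) ∞
    (volume : Measure ℝ) := by
  obtain ⟨K, hK, hb⟩ := h.exists_bounds
  have := h.cont_inv
  have := h.cont1
  have hκ := h.hκ
  refine memLp_top_ofReal (by fun_prop) (C := K * ((2 * κ)⁻¹ * (2 * κ)⁻¹)) fun x => ?_
  rw [abs_mul, abs_mul]
  have h1 := h.abs_inv_le x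
  have h2 := (hb x).2.1
  gcongr

theorem mulL_inv_mem {f : L2} (hf : f ∈ sobolevH 2) : mulL _ h.memLp_inv f ∈ sobolevH 2 := by
  obtain ⟨K, hK, hb⟩ := h.exists_bounds
  have hd := fun x => (h.d1 x).mul ((h.hasDerivAt_inv x).mul (h.hasDerivAt_inv x))
  refine mulL_mem_sobolevH_two (fun x => (h.hasDerivAt_inv x).ofReal_comp)
    (fun x => (hd x).ofReal_comp) _ h.memLp_inv_deriv (memLp_top_ofReal (a := _) ?_
      (C := K * ((2 * κ)⁻¹ * (2 * κ)⁻¹) + K * (K * ((2 * κ)⁻¹ * (2 * κ)⁻¹) * (2 * κ)⁻¹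
        + (2 * κ)⁻¹ * (K * ((2 * κ)⁻¹ * (2 * κ)⁻¹)))) fun x => ?_) hf
  · have := h.cont_inv; have := h.cont1; have := h.cont2
    simp only [Pi.mul_apply]
    fun_prop
  · have hκ := h.hκ
    have h1 := h.abs_inv_le x
    have h2 := (hb x).2.1
    have h3 := (hb x).2.2.1
    simp only [Pi.mul_apply]
    refine (abs_add_le _ _).trans (add_le_add ?_ ?_)
    · rw [abs_mul, abs_mul]; gcongr
    · rw [abs_mul]
      refine mul_le_mul h2 ((abs_add_le _ _).trans (add_le_add ?_ ?_)) (abs_nonneg _) hK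
      · rw [abs_mul, abs_mul, abs_mul]; gcongr
      · rw [abs_mul, abs_mul, abs_mul]; gcongr

theorem mulL_inv_mulL_main (f : L2) : mulL _ h.memLp_inv (mulL _ h.memLp_main f) = f := by
  refine Lp.ext ?_
  filter_upwards [mulL_ae _ h.memLp_inv (mulL _ h.memLp_main f), mulL_ae _ h.memLp_main f]
    with x h1 h2
  have : ((c - Q x : ℝ) : ℂ) ≠ 0 := by exact_mod_cast (h.sub_pos x).ne'
  rw [h1, h2, Complex.ofReal_inv, inv_mul_cancel_left₀ this]

end IsProfile

/-! ### Transfer between `L` and the pencil. -/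

section Wave

variable {κ c : ℝ} {Q : ℝ → ℝ}
  (h : IsProfile κ c Q (deriv Q) (iteratedDeriv 2 Q) (iteratedDeriv 3 Q))
include h

theorem mem_opM_graph (u v : L2) : (u, v) ∈ (opM κ c Q).graph ↔ u ∈ sobolevH 2 ∧
    ∃ u₁ s, (u, u₁) ∈ dX.graph ∧ (mulL _ h.memLp_main u₁, s) ∈ dX.graph ∧
      v = mulL _ h.memLp_pot u - s := by
  have hm : ∀ f g : L2, (f, g) ∈ (mulOp fun x => Q x - c).graph ↔ g = -mulL _ h.memLp_main f := by
    intro f g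
    rw [mem_mulOp_graph]
    constructor
    · intro hg
      refine Lp.ext ?_
      filter_upwards [hg, mulL_ae _ h.memLp_main f, Lp.coeFn_neg (mulL _ h.memLp_main f)]
        with x h1 h2 h3
      rw [h1, h3, Pi.neg_apply, h2]; push_cast; ring
    · rintro rfl
      filter_upwards [mulL_ae _ h.memLp_main f, Lp.coeFn_neg (mulL _ h.memLp_main f)] with x h2 h3
      rw [h3, Pi.neg_apply, h2]; push_cast; ring
  have hp : ∀ f g : L2, (f, g) ∈ (mulOp fun x => iteratedDeriv 2 Q x - 3 * Q x + c - 2 * κ).graph ↔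
      g = mulL _ h.memLp_pot f := by
    intro f g
    rw [mem_mulOp_graph]
    constructor
    · intro hg
      refine Lp.ext ?_
      filter_upwards [hg, mulL_ae _ h.memLp_pot f] with x h1 h2
      rw [h1, h2]
    · rintro rfl
      exact mulL_ae _ h.memLp_pot f
  rw [opM, mem_domRestrict_graph, mem_add_graph]
  refine and_congr_right fun _ => ?_
  simp only [mem_pcomp_graph, hm, hp]
  constructor
  · rintro ⟨a, b, ⟨y, ⟨u₁, hu, rfl⟩, ha⟩, rfl, rfl⟩
    refine ⟨u₁, -a, hu, ?_, by abel⟩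
    simpa using dX.graph.neg_mem ha
  · rintro ⟨u₁, s, hu, hs, rfl⟩
    exact ⟨-s, _, ⟨_, ⟨u₁, hu, rfl⟩, dX.graph.neg_mem hs⟩, rfl, by abel⟩

theorem mem_opL_graph (f y : L2) : (f, y) ∈ (opL κ c Q).graph ↔ f ∈ sobolevH 4 ∧
    ∃ f₁ f₂ s, (f, f₁) ∈ dX.graph ∧ (f₁, f₂) ∈ dX.graph ∧
      (mulL _ h.memLp_main f₂, s) ∈ dX.graph ∧ (s - mulL _ h.memLp_pot f₁, y) ∈ dX.graph := by
  rw [opL, mem_domRestrict_graph, mem_neg_graph]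
  refine and_congr_right fun hf => ?_
  simp only [mem_pcomp_graph, mem_opM_graph h]
  constructor
  · rintro ⟨m, ⟨f₁, hf₁, -, f₂, s, hf₂, hs, rfl⟩, hy⟩
    refine ⟨f₁, f₂, s, hf₁, hf₂, hs, ?_⟩
    simpa using dX.graph.neg_mem hy
  · rintro ⟨f₁, f₂, s, hf₁, hf₂, hs, hy⟩
    refine ⟨_, ⟨f₁, hf₁, ?_, f₂, s, hf₂, hs, rfl⟩, ?_⟩
    -- The domain condition of `M` is automatic on `H⁴`: for `f = J² w` the derivative `f'` equals
    -- `J (∂J w)`.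
    · obtain ⟨w, rfl⟩ := (mem_sobolevH_four_iff f).1 hf
      rw [mem_sobolevH_two_iff]
      exact ⟨opD w, by rw [opJ_opD]; exact dX_unique (opJ_opD_mem _) hf₁⟩
    · simpa using dX.graph.neg_mem hy

theorem opA_eq_of_mem_graph {w y : L2} (hw : (opJ w, y) ∈ (opL κ c Q).graph) :
    h.opA w = opJ y := by
  obtain ⟨-, f₁, f₂, s, hf₁, hf₂, hs, hy⟩ := (mem_opL_graph h _ _).1 hw
  obtain rfl := dX_unique (opJ_opD_mem w) hf₁
  obtain rfl := dX_unique (opD_opDD_mem w) hf₂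
  rw [← opD_eq_of_mem hy, map_sub, opD_eq_opDD_of_mem hs, IsProfile.opA_apply]

/-- Elliptic regularity. -/
theorem mem_graph_of_opA_eq {w y : L2} (hw : h.opA w = opJ y) :
    (opJ w, y) ∈ (opL κ c Q).graph := by
  rw [IsProfile.opA_apply] at hw
  obtain ⟨v, hv⟩ := h.mulL_pot_mem_dX (opD_opDD_mem w)
  set g := mulL _ h.memLp_main (opDD w) with hg
  have hpi : ((4 * Real.pi ^ 2 : ℝ) : ℂ) ≠ 0 := by
    exact_mod_cast (by positivity : (4 * Real.pi ^ 2 : ℝ) ≠ 0)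
  -- The equation reads `∂²J g = J (y + v)`; inserting `∂²J = 4π² (J - 1)` exhibits `g = (c - Q) ∂²J
  -- w` as an element of `H²`. Dividing by `c - Q` puts `∂²J w` in `H²`, hence `J w` in `H⁴`.
  have hg2 : g = opJ (g - ((4 * Real.pi ^ 2 : ℝ) : ℂ)⁻¹ • (y + v)) := by
    rw [map_sub, map_smul, map_add, ← hw, ← opD_eq_of_mem hv, sub_add_cancel, opDD_apply,
      smul_smul, inv_mul_cancel₀ hpi, one_smul]
    abel
  have hgH : g ∈ sobolevH 2 := (mem_sobolevH_two_iff g).2 ⟨_, hg2.symm⟩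
  obtain ⟨s, s', hs, hs'⟩ := (mem_sobolevH_two_iff_dX g).1 hgH
  have hH : opDD w ∈ sobolevH 2 := by
    have := h.mulL_inv_mem hgH
    rwa [hg, h.mulL_inv_mulL_main] at this
  rw [mem_opL_graph h]
  refine ⟨mem_sobolevH_four_of_dX (opJ_opD_mem w) (opD_opDD_mem w) hH, _, _, s, opJ_opD_mem w,
    opD_opDD_mem w, hs, ?_⟩
  rw [mem_dX_iff, map_sub, opD_eq_opDD_of_mem hs, hw]

theorem opL_domain : (opL κ c Q).domain = sobolevH 4 := by
  refine le_antisymm (fun f hf => ?_) (fun f hf => ?_)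
  · exact ((mem_opL_graph h _ _).1 (LinearPMap.mem_graph _ ⟨f, hf⟩)).1
  · obtain ⟨w, rfl⟩ := (mem_sobolevH_four_iff f).1 hf
    have h2 : opDD (opJ w) ∈ sobolevH 2 :=
      (mem_sobolevH_two_iff _).2 ⟨opDD w, (opDD_opJ w).symm⟩
    obtain ⟨s, s', hs, hs'⟩ := (mem_sobolevH_two_iff_dX _).1 (h.mulL_main_mem h2)
    obtain ⟨v, hv⟩ := h.mulL_pot_mem_dX (opD_opDD_mem (opJ w))
    refine LinearPMap.mem_domain_of_mem_graph (y := s' - v) ((mem_opL_graph h _ _).2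
      ⟨hf, _, _, s, opJ_opD_mem _, opD_opDD_mem _, hs, dX.graph.sub_mem hs' hv⟩)

theorem exists_opJ_eq (x : (opL κ c Q).domain) :
    ∃ w, opJ w = x ∧ h.opA w = opJ (opL κ c Q x) := by
  have hx : (x : L2) ∈ sobolevH 4 := opL_domain h ▸ x.2
  obtain ⟨w, hw⟩ := (mem_sobolevH_four_iff _).1 hx
  refine ⟨_, hw, opA_eq_of_mem_graph h ?_⟩
  rw [hw]
  exact LinearPMap.mem_graph _ x

theorem exists_domain_of_pencil_eq {w y : L2} {z : ℂ} (hw : pencil h.opA opJ z w = opJ y) :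
    ∃ x : (opL κ c Q).domain, (x : L2) = opJ w ∧ opL κ c Q x = z • opJ w + y := by
  have h1 : h.opA w = opJ (z • opJ w + y) := by
    rw [map_add, map_smul, ← hw, pencil_apply]; abel
  have h2 := mem_graph_of_opA_eq h h1
  obtain ⟨x, hx, hx'⟩ := (LinearPMap.mem_graph_iff _).1 h2
  exact ⟨x, hx, hx'⟩

theorem isEigenvalue_iff (z : ℂ) :
    IsEigenvalue (opL κ c Q) z ↔ ∃ w, w ≠ 0 ∧ pencil h.opA opJ z w = 0 := by
  constructor
  · rintro ⟨x, hx, hxz⟩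
    obtain ⟨w, hw, hA⟩ := exists_opJ_eq h x
    refine ⟨w, ?_, ?_⟩
    · rintro rfl
      rw [map_zero] at hw
      exact hx (Subtype.ext hw.symm)
    · rw [pencil_apply, hA, hxz, hw, map_smul, sub_self]
  · rintro ⟨w, hw, hp⟩
    obtain ⟨x, hx, hxz⟩ := exists_domain_of_pencil_eq h (y := 0) (by rw [hp, map_zero])
    refine ⟨x, ?_, by rw [hxz, add_zero, hx]⟩
    rintro rfl
    exact hw (opJ_injective w hx.symm)

theorem eigenspace_opL (z : ℂ) : eigenspace (opL κ c Q) z =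
    (pencil h.opA opJ z).ker.map (opJ : L2 →ₗ[ℂ] L2) := by
  ext f
  rw [mem_eigenspace, Submodule.mem_map]
  constructor
  · rintro ⟨x, rfl, hxz⟩
    obtain ⟨w, hw, hA⟩ := exists_opJ_eq h x
    refine ⟨w, ?_, hw⟩
    change pencil h.opA opJ z w = 0
    rw [pencil_apply, hA, hxz, hw, map_smul, sub_self]
  · rintro ⟨w, hw, rfl⟩
    have hp : pencil h.opA opJ z w = 0 := hw
    obtain ⟨x, hx, hxz⟩ := exists_domain_of_pencil_eq h (y := 0) (by rw [hp, map_zero])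
    exact ⟨x, hx, by rw [hxz, add_zero]; rfl⟩

/-- The resolvent of `L` is `J (A - z J²)⁻¹ J`, the inverse being bounded by the open mapping
theorem. -/
theorem mem_resolventSet_of_bijective {z : ℂ}
    (hz : Function.Bijective (pencil h.opA opJ z)) : z ∈ resolventSet (opL κ c Q) := by
  let e := ContinuousLinearEquiv.ofBijective (pencil h.opA opJ z)
    (LinearMap.ker_eq_bot.2 hz.1) (LinearMap.range_eq_top.2 hz.2)
  have he : ∀ w, e w = pencil h.opA opJ z w := fun w => rfl
  refine ⟨opJ ∘L (e.symm : L2 →L[ℂ] L2) ∘L opJ, fun f => ?_, fun x => ?_⟩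
  · have hw : pencil h.opA opJ z (e.symm (opJ f)) = opJ f := by
      rw [← he, e.apply_symm_apply]
    obtain ⟨x, hx, hxz⟩ := exists_domain_of_pencil_eq h hw
    exact ⟨x, hx, by rw [hxz, hx]; abel⟩
  · obtain ⟨w, hw, hA⟩ := exists_opJ_eq h x
    have h1 : opJ (opL κ c Q x - z • (x : L2)) = e w := by
      rw [he, pencil_apply, hA, map_sub, map_smul, hw]
    change opJ (e.symm (opJ (opL κ c Q x - z • (x : L2)))) = x
    rw [h1, e.symm_apply_apply, hw]

end Wave

end CHKP

end

/-! ### The spectrum of `L`. -/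

theorem mainTheorem3 (κ c : ℝ) (hκ : 0 < κ) (hc : 2 * κ < c) (Q : ℝ → ℝ)
    (hQ : CHKP.IsSolitaryWave κ c Q) :
    (CHKP.opL κ c Q).domain = CHKP.sobolevH 4 ∧
    ∃ l : ℝ, l < 0 ∧
      CHKP.IsEigenvalue (CHKP.opL κ c Q) (l : ℂ) ∧
      Module.finrank ℂ (CHKP.eigenspace (CHKP.opL κ c Q) (l : ℂ)) = 1 ∧
      (∀ m : ℝ, m < 0 → CHKP.IsEigenvalue (CHKP.opL κ c Q) (m : ℂ) → m = l) ∧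
      CHKP.spectrum (CHKP.opL κ c Q) \ {(l : ℂ)} ⊆ {z : ℂ | ∃ r : ℝ, 0 ≤ r ∧ z = (r : ℂ)} := by
  have h := CHKP.IsSolitaryWave.isProfile hκ hc hQ
  refine ⟨CHKP.opL_domain h, ?_⟩
  obtain ⟨δ, hδ, C, hgarding⟩ := h.garding
  obtain ⟨k, hk⟩ := h.exists_hyperplane
  obtain ⟨l, hl, hfin, huniq, hbij⟩ := CHKP.exists_unique_negative_eigenvalue_pencil h.opA
    CHKP.opJ k hδ h.inner_opA CHKP.inner_opJ CHKP.opJ_injective hgarding hk h.exists_neg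
  have hinj : Function.Injective CHKP.opJ :=
    (injective_iff_map_eq_zero CHKP.opJ).2 CHKP.opJ_injective
  refine ⟨l, hl, ?_, ?_, fun m hm hme => huniq m hm ((CHKP.isEigenvalue_iff h m).1 hme), ?_⟩
  · rw [CHKP.isEigenvalue_iff h]
    obtain ⟨w, hw, -⟩ := finrank_eq_one_iff'.1 hfin
    exact ⟨w, fun h0 => hw (Subtype.ext h0), w.2⟩
  · rw [CHKP.eigenspace_opL h, ← hfin]
    exact (Submodule.equivMapOfInjective _ hinj _).finrank_eq.symm
  · rintro z ⟨hz, hzl⟩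
    by_contra hr
    exact hz (CHKP.mem_resolventSet_of_bijective h (hbij z hr hzl))
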